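/- For $\mathbf k=(k_1,\dots,k_r)\in(\mathbb Z_{\ge1})^r$ with $r\ge 1$, put $$z_n(\mathbf k;q)=\sum_{n>m_1>\dots>m_r>0}\ \prod_{i=1}^r\frac{q^{(k_i-1)m_i}}{[m_i]_q^{k_i}},\qquad z_n^\star(\mathbf k;q)=\sum_{n>m_1\ge\dots\ge m_r>0}\ \prod_{i=1}^r\frac{q^{(k_i-1)m_i}}{[m_i]_q^{k_i}},\qquad [m]_q=\frac{1-q^m}{1-q}.$$ The limits $$\xi(\mathbf k)=\lim_{n\to\infty}z_n(\mathbf k;e^{2\pi i/n}),\qquad \xi^\star(\mathbf k)=\lim_{n\to\infty}z^\star_n(\mathbf k;e^{2\pi i/n})$$ exist in $\mathbb C$ for every such $\mathbf k$. For integers $k,s\ge 0$ and $r\ge1$ let $I(k,r,s)$ be the set of all $\mathbf k\in(\mathbb Z_{\ge1})^r$ of weight $k_1+\dots+k_r=k$ and height $\#\{a : k_a\ge2\}=s$. Then for all $k,s\ge0$ and $r\ge 1$ $$\sum_{\mathbf k\in I(k,r,s)}\xi(\mathbf k)\in(-2\pi i)^k\,\mathbb Q,\qquad \sum_{\mathbf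 k\in I(k,r,s)}\xi^\star(\mathbf k)\in(-2\pi i)^k\,\mathbb Q .$$ More explicitly, define formal power series in $\mathbb C[[x,y,z]]$ by $$\widetilde F(x,y,z)=1+\sum_{r=1}^\infty\sum_{s=0}^r\sum_{k=r+s}^\infty\Big((-2\pi i)^{-k}\sum_{\mathbf k\in I(k,r,s)}\xi(\mathbf k)\Big)x^{k-r-s}y^{r-s}z^s,$$ $$\widetilde F^\star(x,y,z)=1+\sum_{r=1}^\infty\sum_{s=0}^r\sum_{k=r+s}^\infty\Big((-2\pi i)^{-k}\sum_{\mathbf k\in I(k,r,s)}\xi^\star(\mathbf k)\Big)x^{k-r-s}y^{r-s}z^s .$$ Then, as identities in the field of fractions of $\mathbb C[[x,y,z]]$, $$\widetilde F(x,y,z)=\widetilde U(x,y,z),\qquad \widetilde F^\star(x,y,z)=\widetilde U(x,-y,-z)^{-1},$$ where $$\widetilde U(x,y,z)=e^{y/2}\,\frac{x}{\sinh(x/2)}\,\frac{\cosh\!\big(\tfrac12\sqrt{(x+y)^2-4z}\big)-\cosh\!\big(\tfrac12(x-y)\big)}{xy-z},$$ and $\cosh\big(\tfrac12\sqrt{w}\big)$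 denotes the power series $\sum_{j\ge0}\frac{w^j}{4^j(2j)!}$. -/

import Mathlib

namespace MultHarmonic

/-- The `q`-integer `[m]_q = (1 - q^m) / (1 - q)`. -/
noncomputable def qInt (q : ℂ) (m : ℕ) : ℂ := (1 - q ^ m) / (1 - q)

/-- The summand `∏ i, q^((k_i - 1) m_i) / [m_i]_q^(k_i)`. It is only used for indices all of whose
entries `k_i` are at least `1`, so that the truncated subtraction is the ordinary one. -/
noncomputable def summand {r : ℕ} (k : Fin r → ℕ) (q : ℂ) (m : Fin r → ℕ) : ℂ :=
  ∏ i, q ^ ((k i - 1) * m i) / qInt q (m i) ^ k i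

open Classical in
/-- The finite multiple harmonic `q`-series `z_n(k_1, …, k_r; q)`, a sum over
`n > m_1 > ⋯ > m_r > 0`. -/
noncomputable def z (n : ℕ) {r : ℕ} (k : Fin r → ℕ) (q : ℂ) : ℂ :=
  ∑ m ∈ (Fintype.piFinset fun _ : Fin r => Finset.Ioo 0 n) with StrictAnti m, summand k q m

open Classical in
/-- The star version `z⋆_n(k_1, …, k_r; q)`, a sum over `n > m_1 ≥ ⋯ ≥ m_r > 0`. -/
noncomputable def zStar (n : ℕ) {r : ℕ} (k : Fin r → ℕ) (q : ℂ) : ℂ :=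
  ∑ m ∈ (Fintype.piFinset fun _ : Fin r => Finset.Ioo 0 n) with Antitone m, summand k q m

/-- The root of unity `e^(2πi/n)`. -/
noncomputable def rootE (n : ℕ) : ℂ := Complex.exp (2 * Real.pi * Complex.I / n)

/-- `ξ(k) = lim_{n → ∞} z_n(k; e^(2πi/n))`. -/
noncomputable def xi {r : ℕ} (k : Fin r → ℕ) : ℂ :=
  Filter.limUnder Filter.atTop fun n : ℕ => z n k (rootE n)

/-- `ξ⋆(k) = lim_{n → ∞} z⋆_n(k; e^(2πi/n))`. -/
noncomputable def xiStar {r : ℕ} (k : Fin r → ℕ) : ℂ :=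
  Filter.limUnder Filter.atTop fun n : ℕ => zStar n k (rootE n)

/-- The height of an index: the number of entries that are at least `2`. -/
def height {r : ℕ} (k : Fin r → ℕ) : ℕ := (Finset.univ.filter fun a => 2 ≤ k a).card

/-- `I(w, r, s)`: the finite set of indices `(k_1, …, k_r)` of positive integers of weight `w`,
depth `r` and height `s`. -/
def indexSet (w r s : ℕ) : Finset (Fin r → ℕ) :=
  (Finset.Nat.antidiagonalTuple r w).filter fun k => (∀ a, 1 ≤ k a) ∧ height k = s

theorem mem_indexSet {w r s : ℕ} {k : Fin r → ℕ} :
    k ∈ indexSet w r s ↔ ∑ a, k a = w ∧ (∀ a, 1 ≤ k a) ∧ height k = s := by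
  simp [indexSet, Finset.Nat.mem_antidiagonalTuple]

/-- Formal power series over `ℂ` in three variables `x, y, z`. -/
abbrev Series : Type := MvPowerSeries (Fin 3) ℂ

/-- For a complex valued function `f` of indices, the formal power series
`∑_{r ≥ 1} ∑_{0 ≤ s ≤ r} ∑_{k ≥ r + s} (-2πi)^(-k) (∑_{𝐤 ∈ I(k,r,s)} f 𝐤) x^(k-r-s) y^(r-s) z^s`,
given by its coefficients: the exponent `(e 0, e 1, e 2)` is `(k-r-s, r-s, s)` exactly for `s = e 2`,
`r = e 1 + e 2` and `k = e 0 + e 1 + 2 * e 2`. -/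
noncomputable def genSum (f : ∀ {r : ℕ}, (Fin r → ℕ) → ℂ) : Series :=
  fun e : Fin 3 →₀ ℕ =>
    if 1 ≤ e 1 + e 2 then
      ((-2 * Real.pi * Complex.I) ^ (e 0 + e 1 + 2 * e 2))⁻¹ *
        ∑ k ∈ indexSet (e 0 + e 1 + 2 * e 2) (e 1 + e 2) (e 2), f k
    else 0

/-- The generating function `1 + ∑_{r ≥ 1} ∑_{0 ≤ s ≤ r} ∑_{k ≥ r + s} ⋯` of the normalized sums. -/
noncomputable def genSeries (f : ∀ {r : ℕ}, (Fin r → ℕ) → ℂ) : Series := 1 + genSum f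

/-- The exponential of a formal power series with zero constant term. -/
noncomputable def sExp (a : Series) : Series := (PowerSeries.exp ℂ).subst a

/-- The hyperbolic sine of a formal power series with zero constant term. -/
noncomputable def sSinh (a : Series) : Series := (1 / 2 : ℂ) • (sExp a - sExp (-a))

/-- The hyperbolic cosine of a formal power series with zero constant term. -/
noncomputable def sCosh (a : Series) : Series := (1 / 2 : ℂ) • (sExp a + sExp (-a))

/-- `cosh (√w)` for a formal power series `w` with zero constant term: as `cosh` is even, this is
the series `∑_j w^j / (2j)!`. -/
noncomputable def sCoshSqrt (w : Series) : Series :=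
  (PowerSeries.mk fun j : ℕ => (1 / ((2 * j).factorial : ℂ))).subst w

/-- The field of fractions of `ℂ⟦x, y, z⟧`. -/
abbrev SeriesField : Type := FractionRing Series

/-- `e^(y/2) * (x / sinh (x/2)) * (cosh (½ √((x+y)² - 4z)) - cosh (½ (x-y))) / (xy - z)`, for formal
power series `x, y, z` with zero constant terms, as an element of the field of fractions. Here
`½ √((x+y)² - 4z)` is the square root of `¼ ((x+y)² - 4z)`. -/
noncomputable def U (x y z : Series) : SeriesField :=
  algebraMap Series SeriesField (sExp ((1 / 2 : ℂ) • y)) *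
    (algebraMap Series SeriesField x / algebraMap Series SeriesField (sSinh ((1 / 2 : ℂ) • x))) *
    (algebraMap Series SeriesField
        (sCoshSqrt ((1 / 4 : ℂ) • ((x + y) ^ 2 - 4 * z)) - sCosh ((1 / 2 : ℂ) • (x - y))) /
      algebraMap Series SeriesField (x * y - z))

/-- The three variables. -/
noncomputable def vX : Series := MvPowerSeries.X 0
noncomputable def vY : Series := MvPowerSeries.X 1
noncomputable def vZ : Series := MvPowerSeries.X 2

end MultHarmonic

/-! Existence of the limits. At `q = e^(2πi/n)` the factor `qTerm q k m` is at most a constant times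
`d^(-k)`, with `d` the distance of `m` to the ends of `[0, n]`. It converges as `n → ∞` when `m` or
`n - m` is fixed. Sums with leading entry at least 2 therefore converge by dominated convergence on
each half of `[0, n]`. An entry 1 gives a factor `F` that is not absolutely summable. Its own
partial sums `G = psum F` are harmless, because `F m + F (n - m) = 1 - q` evaluates the full sum;
they grow like a logarithm and converge at both ends. For nested sums the induction carries the
stronger hypothesis `Nice`: the sums of `A` against the differences of every `G^j` are also under
control. Summation by parts turns a new factor `F` into the difference of `G^(j+1)`, up to terms in
`F²` that are absolutely summable (`nice_psum_mul`), so the hypothesis reproduces itself.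

Evaluation. For fixed `n` the generating series over all indices is a product over `m < n` of `1 +
letterSeries` (`zSeries_eq_prod`); the star series is the inverse of the same product with a minus
sign (`zStarSeries_mul_prod`). After clearing denominators each factor is a quadratic polynomial in
`q^m`, so the product over all roots of unity is explicit (`prod_letterSeries`). It involves `(1 +
X)^n`, `(1 + Y)^n` and `(h + √W)^n + (h - √W)^n`, where `nX`, `nY`, `n(h - 1)` and `n²W` converge.
Hence these powers tend to exponentials and to a hyperbolic cosine, which gives `genSeries_xi_mul`
and `genSeries_xiStar_mul`. These are identities between power series with denominators cleared;
dividing yields `U`.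

Rationality. Both sides of the cleared identities are built from series with rational coefficients,
and a quotient of such series, when it is a power series, has rational coefficients
(`mem_ratSeries_of_mul_mem`). -/

namespace MultHarmonic

open Filter Topology
open scoped MvPowerSeries.WithPiTopology

/-! ### Double sequences controlled at both ends of `[0, n]`, and their partial sums. -/

/-- The distance of `m` to the ends of `[0, n]`, plus one. -/
noncomputable def endDist (n m : ℕ) : ℝ := ((min m (n - m) : ℕ) : ℝ) + 1

theorem one_le_endDist (n m : ℕ) : 1 ≤ endDist n m := by
  unfold endDist
  have : (0 : ℝ) ≤ ((min m (n - m) : ℕ) : ℝ) := Nat.cast_nonneg _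
  linarith

theorem endDist_pos (n m : ℕ) : 0 < endDist n m := lt_of_lt_of_le one_pos (one_le_endDist n m)

theorem endDist_rpow_le (n m : ℕ) (s : ℝ) :
    endDist n m ^ s ≤ ((m : ℝ) + 1) ^ s + (((n - m : ℕ) : ℝ) + 1) ^ s := by
  unfold endDist
  rcases min_choice m (n - m) with h | h <;> rw [h]
  · exact le_add_of_nonneg_right (by positivity)
  · exact le_add_of_nonneg_left (by positivity)

/-- The double sequence `A n m` converges as `n → ∞` at fixed distance `m` from the left end and at
fixed distance from the right end of `[0, n]`, and grows at most like the power `s` of the distance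
to the ends. -/
structure Ctrl (s : ℝ) (A : ℕ → ℕ → ℂ) : Prop where
  left : ∀ b, ∃ l, Tendsto (fun n => A n b) atTop (𝓝 l)
  right : ∀ b, ∃ l, Tendsto (fun n => A n (n - b)) atTop (𝓝 l)
  bound : ∃ C, 0 ≤ C ∧ ∀ n m, m < n → ‖A n m‖ ≤ C * endDist n m ^ s

namespace Ctrl

variable {s t : ℝ} {A B : ℕ → ℕ → ℂ}

theorem mono (h : Ctrl s A) (hst : s ≤ t) : Ctrl t A := by
  refine ⟨h.left, h.right, ?_⟩
  obtain ⟨C, hC, hb⟩ := h.bound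
  refine ⟨C, hC, fun n m hm => (hb n m hm).trans ?_⟩
  exact mul_le_mul_of_nonneg_left (Real.rpow_le_rpow_of_exponent_le (one_le_endDist n m) hst) hC

theorem add (hA : Ctrl s A) (hB : Ctrl s B) : Ctrl s (A + B) := by
  refine ⟨fun b => ?_, fun b => ?_, ?_⟩
  · obtain ⟨l, hl⟩ := hA.left b
    obtain ⟨l', hl'⟩ := hB.left b
    exact ⟨_, hl.add hl'⟩
  · obtain ⟨l, hl⟩ := hA.right b
    obtain ⟨l', hl'⟩ := hB.right b
    exact ⟨_, hl.add hl'⟩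
  · obtain ⟨C, hC, hb⟩ := hA.bound
    obtain ⟨C', hC', hb'⟩ := hB.bound
    refine ⟨C + C', by positivity, fun n m hm => ?_⟩
    rw [add_mul]
    exact (norm_add_le _ _).trans (add_le_add (hb n m hm) (hb' n m hm))

theorem mul (hA : Ctrl s A) (hB : Ctrl t B) : Ctrl (s + t) (A * B) := by
  refine ⟨fun b => ?_, fun b => ?_, ?_⟩
  · obtain ⟨l, hl⟩ := hA.left b
    obtain ⟨l', hl'⟩ := hB.left b
    exact ⟨_, hl.mul hl'⟩
  · obtain ⟨l, hl⟩ := hA.right b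
    obtain ⟨l', hl'⟩ := hB.right b
    exact ⟨_, hl.mul hl'⟩
  · obtain ⟨C, hC, hb⟩ := hA.bound
    obtain ⟨C', hC', hb'⟩ := hB.bound
    refine ⟨C * C', by positivity, fun n m hm => ?_⟩
    have hp := endDist_pos n m
    rw [Real.rpow_add hp, Pi.mul_apply, Pi.mul_apply, norm_mul]
    calc _ ≤ (C * endDist n m ^ s) * (C' * endDist n m ^ t) :=
          mul_le_mul (hb n m hm) (hb' n m hm) (norm_nonneg _) (by positivity)
      _ = _ := by ring

theorem const (c : ℂ) : Ctrl 0 (fun _ _ => c) :=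
  ⟨fun _ => ⟨c, tendsto_const_nhds⟩, fun _ => ⟨c, tendsto_const_nhds⟩,
    ‖c‖, norm_nonneg c, fun n m _ => by simp⟩

theorem const_mul (c : ℂ) (hA : Ctrl s A) : Ctrl s ((fun _ _ => c) * A) := by
  simpa using (const c).mul hA

theorem sub (hA : Ctrl s A) (hB : Ctrl s B) : Ctrl s (A - B) := by
  have : A - B = A + (fun _ _ => (-1 : ℂ)) * B := by
    ext n m; simp [sub_eq_add_neg]
  rw [this]
  exact hA.add (hB.const_mul (-1))

end Ctrl

/-- Partial sums in the second argument. -/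
def psum (d : ℕ → ℕ → ℂ) : ℕ → ℕ → ℂ := fun n b => ∑ m ∈ Finset.range b, d n m

theorem psum_add (d d' : ℕ → ℕ → ℂ) : psum (d + d') = psum d + psum d' := by
  ext n b; simp [psum, Finset.sum_add_distrib]

theorem psum_const_mul (c : ℂ) (d : ℕ → ℕ → ℂ) :
    psum ((fun _ _ => c) * d) = (fun _ _ => c) * psum d := by
  ext n b; simp [psum, Finset.mul_sum]

theorem psum_left {d : ℕ → ℕ → ℂ} (h : ∀ b, ∃ l, Tendsto (fun n => d n b) atTop (𝓝 l)) (b : ℕ) :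
    ∃ l, Tendsto (fun n => psum d n b) atTop (𝓝 l) := by
  choose l hl using h
  exact ⟨_, tendsto_finsetSum (Finset.range b) fun m _ => hl m⟩

/-- The sum is cut at `n / 2` and the upper half is indexed by the distance `j = n - m` to the right
end, so that each half has termwise limits as `n → ∞`. -/
theorem sum_range_split_half (d : ℕ → ℂ) (n b : ℕ) :
    ∑ m ∈ Finset.range (n - b), d m =
      ∑ m ∈ Finset.range (n + 1), (if 2 * m ≤ n ∧ m < n - b then d m else 0) +
        ∑ j ∈ Finset.range (n + 1), (if 2 * j < n ∧ b < j then d (n - j) else 0) := by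
  have h2 : ∑ j ∈ Finset.range (n + 1), (if 2 * j < n ∧ b < j then d (n - j) else 0) =
      ∑ m ∈ Finset.range (n + 1), (if n < 2 * m ∧ m < n - b then d m else 0) := by
    rw [← Finset.sum_range_reflect]
    refine Finset.sum_congr rfl fun j hj => ?_
    rw [Finset.mem_range] at hj
    have e : n - (n + 1 - 1 - j) = j := by omega
    rw [e]
    exact if_congr (by omega) rfl rfl
  rw [h2, ← Finset.sum_add_distrib, ← Finset.sum_subset
    (Finset.range_subset_range.2 (by omega : n - b ≤ n + 1))]
  · refine Finset.sum_congr rfl fun m hm => ?_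
    rw [Finset.mem_range] at hm
    by_cases h : 2 * m ≤ n
    · simp [h, hm, not_lt.2 h]
    · simp [h, hm, not_le.1 h]
  · intro m _ hm
    rw [Finset.mem_range] at hm
    simp [hm]

theorem summable_succ_rpow {s : ℝ} (hs : s < -1) : Summable fun m : ℕ => ((m : ℝ) + 1) ^ s := by
  have := (summable_nat_add_iff 1).2 (Real.summable_nat_rpow.2 hs)
  simpa using this

/-- Dominated convergence applies on each half of `[0, n]` with the summable majorant `C (m + 1)^s`.
Left limits are limits of finite sums. -/
theorem Ctrl.psum {s : ℝ} {d : ℕ → ℕ → ℂ} (h : Ctrl s d) (hs : s < -1) : Ctrl 0 (psum d) := by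
  obtain ⟨C, hC, hb⟩ := h.bound
  have hsum := summable_succ_rpow hs
  refine ⟨psum_left h.left, fun b => ?_, ?_⟩
  · obtain ⟨l, hl⟩ := Classical.axiom_of_choice h.left
    obtain ⟨r, hr⟩ := Classical.axiom_of_choice h.right
    have t1 := tendsto_tsum_of_dominated_convergence
      (f := fun n m => if 2 * m ≤ n ∧ m < n - b then d n m else 0) (g := l) (𝓕 := atTop)
      (bound := fun m => C * ((m : ℝ) + 1) ^ s) (hsum.mul_left C)
      (fun m => by
        refine (hl m).congr' ?_
        filter_upwards [eventually_gt_atTop (2 * m + b)] with n hn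
        rw [if_pos (by omega)])
      (by
        refine Eventually.of_forall fun n m => ?_
        split_ifs with hc
        · refine (hb n m (by omega)).trans_eq ?_
          rw [endDist, min_eq_left (by omega)]
        · rw [norm_zero]; positivity)
    have t2 := tendsto_tsum_of_dominated_convergence
      (f := fun n j => if 2 * j < n ∧ b < j then d n (n - j) else 0)
      (g := fun j => if b < j then r j else 0) (𝓕 := atTop)
      (bound := fun m => C * ((m : ℝ) + 1) ^ s) (hsum.mul_left C)
      (fun j => by
        by_cases hj : b < j
        · simp only [hj, if_true]
          refine (hr j).congr' ?_
          filter_upwards [eventually_gt_atTop (2 * j)] with n hn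
          rw [if_pos ⟨hn, trivial⟩]
        · simp [hj])
      (by
        refine Eventually.of_forall fun n m => ?_
        split_ifs with hc
        · refine (hb n (n - m) (by omega)).trans_eq ?_
          rw [endDist, min_eq_right (by omega), Nat.sub_sub_self (by omega)]
        · rw [norm_zero]; positivity)
    refine ⟨_, (t1.add t2).congr fun n => ?_⟩
    rw [MultHarmonic.psum, sum_range_split_half, tsum_eq_sum (s := Finset.range (n + 1)),
      tsum_eq_sum (s := Finset.range (n + 1))]
    · intro j hj
      rw [Finset.mem_range] at hj
      rw [if_neg (by omega)]
    · intro j hj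
      rw [Finset.mem_range] at hj
      rw [if_neg (by omega)]
  · have hT : ∀ n : ℕ, ∑ m ∈ Finset.range n, ((m : ℝ) + 1) ^ s ≤ ∑' m : ℕ, ((m : ℝ) + 1) ^ s :=
      fun n => hsum.sum_le_tsum _ fun m _ => by positivity
    refine ⟨C * (2 * ∑' m : ℕ, ((m : ℝ) + 1) ^ s),
      mul_nonneg hC (mul_nonneg two_pos.le (tsum_nonneg fun m => by positivity)), fun n b hbn => ?_⟩
    rw [Real.rpow_zero, mul_one]
    calc ‖MultHarmonic.psum d n b‖ ≤ ∑ m ∈ Finset.range b, ‖d n m‖ := norm_sum_le _ _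
      _ ≤ ∑ m ∈ Finset.range n, ‖d n m‖ :=
          Finset.sum_le_sum_of_subset_of_nonneg (Finset.range_subset_range.2 hbn.le)
            fun _ _ _ => norm_nonneg _
      _ ≤ ∑ m ∈ Finset.range n, C * (((m : ℝ) + 1) ^ s + (((n - m : ℕ) : ℝ) + 1) ^ s) := by
          refine Finset.sum_le_sum fun m hm => (hb n m (Finset.mem_range.1 hm)).trans ?_
          exact mul_le_mul_of_nonneg_left (endDist_rpow_le n m s) hC
      _ ≤ _ := by
          rw [← Finset.mul_sum, Finset.sum_add_distrib, two_mul]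
          refine mul_le_mul_of_nonneg_left (add_le_add (hT n) ?_) hC
          rw [← Finset.sum_range_reflect]
          calc _ ≤ ∑ m ∈ Finset.range n, (((m + 1 : ℕ) : ℝ) + 1) ^ s := by
                refine Finset.sum_le_sum fun m hm => ?_
                rw [Finset.mem_range] at hm
                rw [show n - (n - 1 - m) = m + 1 by omega]
            _ ≤ ∑ m ∈ Finset.range (n + 1), ((m : ℝ) + 1) ^ s := by
                rw [Finset.sum_range_succ']
                exact le_add_of_nonneg_right (by positivity)
            _ ≤ _ := hT _

/-! ### Growth slower than every power, and summation by parts. -/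

/-- Controlled with every positive exponent. -/
def Tame (A : ℕ → ℕ → ℂ) : Prop := ∀ ε : ℝ, 0 < ε → Ctrl ε A

namespace Tame

variable {A B : ℕ → ℕ → ℂ}

theorem of_ctrl_zero (h : Ctrl 0 A) : Tame A := fun _ hε => h.mono hε.le

theorem add (hA : Tame A) (hB : Tame B) : Tame (A + B) := fun ε hε => (hA ε hε).add (hB ε hε)

theorem sub (hA : Tame A) (hB : Tame B) : Tame (A - B) := fun ε hε => (hA ε hε).sub (hB ε hε)

theorem mul (hA : Tame A) (hB : Tame B) : Tame (A * B) := fun ε hε => by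
  simpa using (hA (ε / 2) (by positivity)).mul (hB (ε / 2) (by positivity))

theorem const (c : ℂ) : Tame (fun _ _ => c) := of_ctrl_zero (Ctrl.const c)

theorem pow (hA : Tame A) (j : ℕ) : Tame (A ^ j) := by
  induction j with
  | zero => rw [pow_zero]; exact const 1
  | succ j ih => rw [pow_succ]; exact ih.mul hA

end Tame

theorem Ctrl.mul_tame {s t : ℝ} {d A : ℕ → ℕ → ℂ} (hd : Ctrl s d) (hA : Tame A) (hst : s < t) :
    Ctrl t (d * A) := by
  simpa using hd.mul (hA (t - s) (sub_pos.2 hst))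

/-- Summation by parts against the differences of a power of a partial sum. -/
theorem psum_diff_pow_mul (F d : ℕ → ℕ → ℂ) (j : ℕ) :
    psum (((psum F + F) ^ j - psum F ^ j) * psum d) =
      psum F ^ j * psum d - psum ((psum F + F) ^ j * d) := by
  -- Since `psum F + F` at `b` is `psum F` at `b + 1`, the first factor is the forward difference of
  -- `psum F ^ j`.
  ext n b
  simp only [Pi.sub_apply, Pi.mul_apply, Pi.pow_apply]
  induction b with
  | zero => simp [psum]
  | succ b ih =>
    simp only [psum, Finset.sum_range_succ, Pi.sub_apply, Pi.mul_apply, Pi.pow_apply,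
      Pi.add_apply] at ih ⊢
    rw [ih]
    ring

/-- Linear approximation of the difference of two powers. -/
theorem exists_add_pow_sub_pow {G F : ℕ → ℕ → ℂ} (hG : Tame G) (hF : Tame F) (j : ℕ) :
    ∃ Q, Tame Q ∧ (G + F) ^ (j + 1) - G ^ (j + 1) =
      (fun _ _ => (j + 1 : ℂ)) * ((G + F) ^ j * F) - F * F * Q := by
  induction j with
  | zero =>
    refine ⟨fun _ _ => 0, Tame.const 0, ?_⟩
    ext n m
    simp
  | succ j ih =>
    obtain ⟨Q, hQ, h⟩ := ih
    refine ⟨Q * G + (fun _ _ => (j + 1 : ℂ)) * (G + F) ^ j,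
      (hQ.mul hG).add ((Tame.const _).mul ((hG.add hF).pow j)), ?_⟩
    ext n m
    have h' := congrFun (congrFun h n) m
    simp only [Pi.sub_apply, Pi.mul_apply, Pi.pow_apply, Pi.add_apply] at h' ⊢
    push_cast
    linear_combination (G n m) * h'

/-- `A` and its sums against differences of powers of `psum F` are tame. -/
structure Nice (F A : ℕ → ℕ → ℂ) : Prop where
  tame : Tame A
  tame_psum : ∀ j : ℕ, Tame (psum (((psum F + F) ^ j - psum F ^ j) * A))

section

variable {F A : ℕ → ℕ → ℂ}

theorem Ctrl.tame_of_neg (hF : Ctrl (-1) F) : Tame F := fun _ hε => hF.mono (by linarith)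

/-- After summation by parts the remaining sum is still absolutely controlled: a tame factor costs
an arbitrarily small exponent. -/
theorem nice_psum_of_ctrl (hF : Ctrl (-1) F) (hG : Tame (psum F)) {s : ℝ} (hs : s < -1) {d : ℕ → ℕ → ℂ} (hd : Ctrl s d) :
    Nice F (psum d) := by
  have hF' := hF.tame_of_neg
  have h1 : Tame (psum d) := .of_ctrl_zero (hd.psum hs)
  refine ⟨h1, fun j => ?_⟩
  rw [psum_diff_pow_mul]
  refine ((hG.pow j).mul h1).sub (.of_ctrl_zero ?_)
  rw [mul_comm]
  -- The midpoint of `s` and `-1` leaves room for the tame factor while staying below `-1`.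
  have hs' : s < (s - 1) / 2 := by linarith
  exact (hd.mul_tame ((hG.add hF').pow j) hs').psum (by linarith)

/-- With `G = psum F`, summation by parts leaves the sum of `(G + F)^j F A`. Up to the factor `1 /
(j + 1)` this is `A` against the difference of `G^(j+1)`, covered by `hA`, plus a term with `F²`, of
exponent below `-1`. This is why `Nice` asks for all powers `j` at once. -/
theorem nice_psum_mul (hF : Ctrl (-1) F) (hG : Tame (psum F)) (hA : Nice F A) : Nice F (psum (F * A)) := by
  have hF' := hF.tame_of_neg
  have h1 : Tame (psum (F * A)) := by simpa using hA.tame_psum 1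
  refine ⟨h1, fun j => ?_⟩
  rw [psum_diff_pow_mul]
  refine ((hG.pow j).mul h1).sub ?_
  obtain ⟨Q, hQ, h⟩ := exists_add_pow_sub_pow hG hF' j
  have hj : ((j : ℂ) + 1) ≠ 0 := Nat.cast_add_one_ne_zero j
  have key : (psum F + F) ^ j * (F * A) = (fun _ _ => ((j + 1 : ℂ))⁻¹) *
      ((((psum F + F) ^ (j + 1) - psum F ^ (j + 1)) * A) + F * F * (Q * A)) := by
    rw [h]
    ext n m
    simp only [Pi.sub_apply, Pi.mul_apply, Pi.pow_apply, Pi.add_apply]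
    field_simp
    ring
  rw [key, psum_const_mul, psum_add]
  refine (Tame.const _).mul ((hA.tame_psum (j + 1)).add (.of_ctrl_zero ?_))
  exact ((hF.mul hF).mul_tame (hQ.mul hA.tame) (t := -3 / 2) (by norm_num)).psum (by norm_num)

theorem Nice.add {B : ℕ → ℕ → ℂ} (hA : Nice F A) (hB : Nice F B) : Nice F (A + B) := by
  refine ⟨hA.tame.add hB.tame, fun j => ?_⟩
  rw [mul_add, psum_add]
  exact (hA.tame_psum j).add (hB.tame_psum j)

/-- Against the constant 1 the differences telescope; the term `0 ^ j` is the value of `psum F ^ j`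
at `0`. -/
theorem nice_one (hG : Tame (psum F)) : Nice F (fun _ _ => 1) := by
  refine ⟨Tame.const 1, fun j => ?_⟩
  have : psum (((psum F + F) ^ j - psum F ^ j) * fun _ _ => 1) =
      psum F ^ j - fun _ _ => (0 : ℂ) ^ j := by
    ext n b
    simp only [Pi.sub_apply, Pi.pow_apply]
    induction b with
    | zero => simp [psum]
    | succ b ih =>
      simp only [psum, Finset.sum_range_succ, Pi.sub_apply, Pi.mul_apply, Pi.pow_apply,
        Pi.add_apply] at ih ⊢
      rw [ih]
      ring
  rw [this]
  exact (hG.pow j).sub (Tame.const _)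

end

/-! ### Estimates and limits of `q`-integers at `e^(2πi/n)`. -/

theorem rootE_primitive {n : ℕ} (hn : n ≠ 0) : IsPrimitiveRoot (rootE n) n :=
  Complex.isPrimitiveRoot_exp n hn

theorem rootE_ne_one {n : ℕ} (hn : 2 ≤ n) : rootE n ≠ 1 :=
  (rootE_primitive (by omega)).ne_one (by omega)

theorem rootE_ne_zero (n : ℕ) : rootE n ≠ 0 := Complex.exp_ne_zero _

theorem rootE_pow_self {n : ℕ} (hn : n ≠ 0) : rootE n ^ n = 1 := (rootE_primitive hn).pow_eq_one

theorem rootE_pow_ne_one {n m : ℕ} (hm : 0 < m) (hmn : m < n) : rootE n ^ m ≠ 1 :=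
  (rootE_primitive (by omega)).pow_ne_one_of_pos_of_lt hm.ne' hmn

theorem rootE_pow_eq (n m : ℕ) :
    rootE n ^ m = Complex.exp (Complex.I * ((2 * Real.pi * m / n : ℝ) : ℂ)) := by
  rw [rootE, ← Complex.exp_nat_mul]
  congr 1
  push_cast
  ring

theorem norm_one_sub_rootE_le (n : ℕ) : ‖1 - rootE n‖ ≤ 2 * Real.pi / n := by
  have h := rootE_pow_eq n 1
  rw [pow_one] at h
  rw [norm_sub_rev, h]
  refine Real.norm_exp_I_mul_ofReal_sub_one_le.trans_eq ?_
  rw [Real.norm_of_nonneg (by positivity)]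
  simp

/-- The norm is `2 |sin (πm/n)|`, and Jordan's inequality `sin x ≥ 2x/π` applies on `[0, π/2]`,
after reflecting `m` to `n - m` when `2m ≥ n`. -/
theorem le_norm_one_sub_rootE_pow {n m : ℕ} (hm : 0 < m) (hmn : m < n) :
    4 * ((min m (n - m) : ℕ) : ℝ) / n ≤ ‖1 - rootE n ^ m‖ := by
  have hn : (0 : ℝ) < n := by exact_mod_cast (by omega : 0 < n)
  have hπ := Real.pi_pos
  have key : ∀ j : ℕ, 2 * j ≤ n → 2 * (j : ℝ) / n ≤ Real.sin (Real.pi * j / n) := by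
    intro j hj
    have hj' : 2 * (j : ℝ) ≤ n := by exact_mod_cast hj
    have := Real.mul_le_sin (x := Real.pi * j / n) (by positivity)
      (by rw [div_le_div_iff₀ hn two_pos]; nlinarith)
    refine le_of_eq_of_le ?_ this
    field_simp
  have hs : 2 * ((min m (n - m) : ℕ) : ℝ) / n ≤ Real.sin (Real.pi * m / n) := by
    rcases le_total (2 * m) n with h | h
    · rw [min_eq_left (by omega)]
      exact key m h
    · rw [min_eq_right (by omega), ← Real.sin_pi_sub]
      refine (key (n - m) (by omega)).trans_eq ?_
      congr 1
      rw [Nat.cast_sub hmn.le]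
      field_simp
  rw [norm_sub_rev, rootE_pow_eq, Complex.norm_exp_I_mul_ofReal_sub_one, Real.norm_eq_abs]
  refine le_trans ?_ (le_abs_self _)
  rw [show 2 * Real.pi * m / n / 2 = Real.pi * m / n by ring]
  calc _ = 2 * (2 * ((min m (n - m) : ℕ) : ℝ) / n) := by ring
    _ ≤ _ := by linarith

/-- The two preceding estimates give `2 min(m, n - m) / π`; the factor 2 absorbs the `+ 1` in
`endDist`, as the minimum is at least 1. -/
theorem le_norm_qInt {n m : ℕ} (hm : 0 < m) (hmn : m < n) :
    endDist n m / Real.pi ≤ ‖qInt (rootE n) m‖ := by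
  have hn : (0 : ℝ) < n := by exact_mod_cast (by omega : 0 < n)
  have hπ := Real.pi_pos
  have h0 : 0 < ‖1 - rootE n‖ := norm_pos_iff.2 (sub_ne_zero.2 (rootE_ne_one (by omega)).symm)
  have h1 : (1 : ℝ) ≤ ((min m (n - m) : ℕ) : ℝ) := by exact_mod_cast (by omega : 1 ≤ min m (n - m))
  rw [qInt, norm_div, le_div_iff₀ h0]
  refine le_trans ?_ (le_norm_one_sub_rootE_pow hm hmn)
  calc _ ≤ endDist n m / Real.pi * (2 * Real.pi / n) :=
        mul_le_mul_of_nonneg_left (norm_one_sub_rootE_le n)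
          (div_nonneg (endDist_pos n m).le hπ.le)
    _ = 2 * endDist n m / n := by field_simp
    _ ≤ _ := by
        rw [endDist]
        exact div_le_div_of_nonneg_right (by linarith) hn.le

theorem tendsto_rootE : Tendsto rootE atTop (𝓝 1) := by
  rw [tendsto_iff_norm_sub_tendsto_zero]
  refine squeeze_zero (g := fun n : ℕ => 2 * Real.pi / n) (fun _ => norm_nonneg _)
    (fun n => by rw [norm_sub_rev]; exact norm_one_sub_rootE_le n) ?_
  exact tendsto_const_nhds.div_atTop tendsto_natCast_atTop_atTop

theorem tendsto_qInt (m : ℕ) : Tendsto (fun n => qInt (rootE n) m) atTop (𝓝 m) := by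
  have h : Tendsto (fun n => ∑ j ∈ Finset.range m, rootE n ^ j) atTop
      (𝓝 (∑ j ∈ Finset.range m, (1 : ℂ) ^ j)) :=
    tendsto_finsetSum _ fun j _ => tendsto_rootE.pow j
  simp only [one_pow, Finset.sum_const, Finset.card_range, nsmul_eq_mul, mul_one] at h
  refine h.congr' ?_
  filter_upwards [eventually_ge_atTop 2] with n hn
  rw [qInt, eq_div_iff (sub_ne_zero.2 (rootE_ne_one hn).symm)]
  exact geom_sum_mul_neg _ _

theorem qInt_zero (q : ℂ) : qInt q 0 = 0 := by simp [qInt]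

theorem rootE_pow_sub {n b : ℕ} (hb : b < n) : rootE n ^ (n - b) = (rootE n ^ b)⁻¹ := by
  rw [pow_sub₀ _ (rootE_ne_zero n) hb.le, rootE_pow_self (by omega), one_mul]

theorem qInt_sub {n b : ℕ} (hb : b < n) :
    qInt (rootE n) (n - b) = -(rootE n ^ b)⁻¹ * qInt (rootE n) b := by
  have := pow_ne_zero b (rootE_ne_zero n)
  rw [qInt, qInt, rootE_pow_sub hb]
  field_simp
  ring

/-- The factor attached to the entry `k` and the summation variable `m`. -/
noncomputable def qTerm (q : ℂ) (k m : ℕ) : ℂ := q ^ ((k - 1) * m) / qInt q m ^ k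

/-- By the convention for division by zero; it allows sums over `range n` in place of `0 < m < n`.
-/
theorem qTerm_zero (q : ℂ) {k : ℕ} (hk : 1 ≤ k) : qTerm q k 0 = 0 := by
  simp [qTerm, qInt_zero, zero_pow (by omega : k ≠ 0)]

/-- The limits come from `[m] → m` and, at the right end, from `[n - b] = -q^(-b) [b]`. -/
theorem ctrl_qTerm {k : ℕ} (hk : 1 ≤ k) : Ctrl (-(k : ℝ)) fun n m => qTerm (rootE n) k m := by
  have hk0 : k ≠ 0 := by omega
  refine ⟨fun b => ?_, fun b => ?_, Real.pi ^ k, by positivity, fun n m hmn => ?_⟩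
  · rcases Nat.eq_zero_or_pos b with rfl | hb
    · exact ⟨0, by simpa only [qTerm_zero _ hk] using tendsto_const_nhds⟩
    · exact ⟨_, (tendsto_rootE.pow _).div ((tendsto_qInt b).pow k)
        (pow_ne_zero _ (Nat.cast_ne_zero.2 hb.ne'))⟩
  · have hE : ∀ᶠ n in atTop, ((rootE n ^ b)⁻¹) ^ (k - 1) /
        (-(rootE n ^ b)⁻¹ * qInt (rootE n) b) ^ k = qTerm (rootE n) k (n - b) := by
      filter_upwards [eventually_gt_atTop b] with n hn
      rw [qTerm, qInt_sub hn, mul_comm (k - 1), pow_mul, rootE_pow_sub hn]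
    rcases Nat.eq_zero_or_pos b with rfl | hb
    · refine ⟨0, Tendsto.congr' hE ?_⟩
      simp [qInt_zero, hk0]
    · have h1 : Tendsto (fun n => (rootE n ^ b)⁻¹) atTop (𝓝 (1 ^ b)⁻¹) :=
        (tendsto_rootE.pow b).inv₀ (by simp)
      exact ⟨_, Tendsto.congr' hE
        ((h1.pow _).div ((h1.neg.mul (tendsto_qInt b)).pow k) (by simp [hk0, hb.ne']))⟩
  · rcases Nat.eq_zero_or_pos m with rfl | hm
    · rw [qTerm_zero _ hk, norm_zero]
      have := endDist_pos n 0
      positivity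
    · have h := le_norm_qInt hm hmn
      have hd := endDist_pos n m
      have hζ : ‖rootE n‖ = 1 := (rootE_primitive (by omega)).norm'_eq_one (by omega)
      rw [qTerm, norm_div, norm_pow, norm_pow, hζ, one_pow, Real.rpow_neg hd.le, Real.rpow_natCast,
        ← div_eq_mul_inv, ← div_pow, ← one_div_pow]
      refine pow_le_pow_left₀ (by positivity) ?_ k
      rw [one_div, ← inv_div]
      exact inv_anti₀ (by positivity) h

theorem qTerm_one_add_reflect {n m : ℕ} (hm : 0 < m) (hmn : m < n) :
    qTerm (rootE n) 1 m + qTerm (rootE n) 1 (n - m) = 1 - rootE n := by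
  have h0 := pow_ne_zero m (rootE_ne_zero n)
  have h1 : 1 - rootE n ≠ 0 := sub_ne_zero.2 (rootE_ne_one (by omega)).symm
  have h2 : 1 - rootE n ^ m ≠ 0 := sub_ne_zero.2 (rootE_pow_ne_one hm hmn).symm
  simp only [qTerm, qInt_sub hmn, Nat.sub_self, zero_mul, pow_zero, pow_one]
  rw [qInt]
  field_simp
  ring

/-- Adding the sum to its reflection `m ↦ n - m` gives `n - 1` equal terms `1 - q`. -/
theorem psum_qTerm_one_full (n : ℕ) :
    psum (fun n m => qTerm (rootE n) 1 m) n n = (1 - rootE n) * ((n - 1 : ℕ) : ℂ) / 2 := by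
  rcases Nat.eq_zero_or_pos n with rfl | hn
  · simp [psum]
  obtain ⟨N, rfl⟩ : ∃ N, n = N + 1 := ⟨n - 1, by omega⟩
  rw [psum, Finset.sum_range_succ', qTerm_zero _ le_rfl, add_zero, eq_div_iff two_ne_zero, mul_two]
  nth_rewrite 2 [← Finset.sum_range_reflect]
  have hc : (1 - rootE (N + 1)) * (N : ℂ) = ∑ _m ∈ Finset.range N, (1 - rootE (N + 1)) := by
    rw [Finset.sum_const, Finset.card_range, nsmul_eq_mul, mul_comm]
  rw [← Finset.sum_add_distrib, Nat.add_sub_cancel, hc]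
  refine Finset.sum_congr rfl fun m hm => ?_
  rw [Finset.mem_range] at hm
  rw [← qTerm_one_add_reflect (n := N + 1) (m := m + 1) (by omega) (by omega)]
  congr 2
  omega

theorem tendsto_nat_mul_one_sub_rootE :
    Tendsto (fun n : ℕ => (n : ℂ) * (1 - rootE n)) atTop (𝓝 (-2 * Real.pi * Complex.I)) := by
  have hc : (2 * Real.pi * Complex.I : ℂ) ≠ 0 := Complex.two_pi_I_ne_zero
  have h := (Complex.hasDerivAt_exp 0).tendsto_slope_zero
  have ht : Tendsto (fun n : ℕ => (2 * Real.pi * Complex.I : ℂ) / n) atTop (𝓝[≠] 0) := by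
    refine tendsto_nhdsWithin_iff.2 ⟨?_, ?_⟩
    · exact tendsto_const_div_atTop_nhds_zero_nat _
    · filter_upwards [eventually_ne_atTop 0] with n hn
      exact div_ne_zero hc (Nat.cast_ne_zero.2 hn)
  have h2 := (h.comp ht).const_mul (-(2 * Real.pi * Complex.I : ℂ))
  rw [Complex.exp_zero, mul_one] at h2
  rw [show (-2 * Real.pi * Complex.I : ℂ) = -(2 * Real.pi * Complex.I) by ring]
  refine h2.congr' ?_
  filter_upwards [eventually_ne_atTop 0] with n hn
  have hn' : (n : ℂ) ≠ 0 := Nat.cast_ne_zero.2 hn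
  simp only [Function.comp_apply, zero_add, smul_eq_mul, inv_div, rootE]
  field_simp
  ring

theorem sum_inv_succ_le {ε : ℝ} (hε : 0 < ε) (b : ℕ) :
    ∑ i ∈ Finset.range b, ((i : ℝ) + 1)⁻¹ ≤ (1 + 1 / ε) * ((b : ℝ) + 1) ^ ε := by
  have h := harmonic_le_one_add_log b
  rw [harmonic] at h
  push_cast at h
  have h1 : (1 : ℝ) ≤ ((b : ℝ) + 1) ^ ε :=
    Real.one_le_rpow (by linarith [(Nat.cast_nonneg b : (0 : ℝ) ≤ b)]) hε.le
  have h2 : Real.log b ≤ ((b : ℝ) + 1) ^ ε / ε :=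
    (Real.log_le_rpow_div (Nat.cast_nonneg b) hε).trans (by gcongr; linarith)
  refine h.trans ?_
  rw [add_mul, one_mul, one_div, inv_mul_eq_div]
  exact add_le_add h1 h2

/-- In the left half the bound is that of a harmonic sum. In the right half one subtracts from the
full sum, which has norm at most `π`, a harmonic sum counted from the right end. -/
theorem tame_psum_qTerm_one : Tame (psum fun n m => qTerm (rootE n) 1 m) := by
  intro ε hε
  have hF := ctrl_qTerm (k := 1) le_rfl
  refine ⟨psum_left hF.left, fun b => ?_, ?_⟩
  -- The case `b = 0` is the explicit full sum; each further step removes one term with a known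
  -- right limit.
  · induction b with
    | zero =>
      have h := (tendsto_nat_mul_one_sub_rootE.sub 
        (tendsto_const_nhds (x := (1 : ℂ)).sub tendsto_rootE)).div_const 2
      refine ⟨_, h.congr' ?_⟩
      filter_upwards [eventually_ge_atTop 1] with n hn
      rw [Nat.sub_zero, psum_qTerm_one_full, Nat.cast_sub hn]
      push_cast
      ring
    | succ b ih =>
      obtain ⟨l, hl⟩ := ih
      obtain ⟨l', hl'⟩ := hF.right (b + 1)
      refine ⟨_, (hl.sub hl').congr' ?_⟩
      filter_upwards [eventually_ge_atTop (b + 1)] with n hn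
      rw [psum, psum, show n - b = n - (b + 1) + 1 by omega, Finset.sum_range_succ, add_sub_cancel_right]
  · obtain ⟨C, hC, hb⟩ := hF.bound
    have hb' : ∀ n m, m < n → ‖qTerm (rootE n) 1 m‖ ≤ C * (endDist n m)⁻¹ := fun n m hm => by
      simpa [Real.rpow_neg_one] using hb n m hm
    refine ⟨Real.pi + C * (1 + 1 / ε), by positivity, fun n b hbn => ?_⟩
    have h1 : 1 ≤ endDist n b ^ ε := Real.one_le_rpow (one_le_endDist n b) hε.le
    have hn : (0 : ℝ) < n := by exact_mod_cast (by omega : 0 < n)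
    rcases le_total (2 * b) n with h | h
    · have hd : endDist n b = b + 1 := by rw [endDist, min_eq_left (by omega)]
      have : ‖psum (fun n m => qTerm (rootE n) 1 m) n b‖ ≤
          C * ((1 + 1 / ε) * endDist n b ^ ε) := by
        rw [hd]
        calc _ ≤ ∑ m ∈ Finset.range b, ‖qTerm (rootE n) 1 m‖ := norm_sum_le _ _
          _ ≤ ∑ m ∈ Finset.range b, C * ((m : ℝ) + 1)⁻¹ := by
              refine Finset.sum_le_sum fun m hm => ?_
              rw [Finset.mem_range] at hm
              refine (hb' n m (by omega)).trans_eq ?_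
              rw [endDist, min_eq_left (by omega)]
          _ ≤ _ := by
              rw [← Finset.mul_sum]
              exact mul_le_mul_of_nonneg_left (sum_inv_succ_le hε b) hC
      refine this.trans ?_
      rw [add_mul Real.pi, mul_assoc C]
      exact le_add_of_nonneg_left (by positivity)
    · have hd : endDist n b = ((n - b : ℕ) : ℝ) + 1 := by rw [endDist, min_eq_right (by omega)]
      have hsplit : psum (fun n m => qTerm (rootE n) 1 m) n b =
          psum (fun n m => qTerm (rootE n) 1 m) n n - ∑ m ∈ Finset.Ico b n, qTerm (rootE n) 1 m := by
        rw [Finset.sum_Ico_eq_sub _ hbn.le]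
        simp [psum]
      have hA : ‖psum (fun n m => qTerm (rootE n) 1 m) n n‖ ≤ Real.pi := by
        rw [psum_qTerm_one_full, norm_div, norm_mul, Complex.norm_natCast, Complex.norm_two]
        calc _ ≤ 2 * Real.pi / n * n / 2 := by
              gcongr
              · exact norm_one_sub_rootE_le n
              · omega
          _ = Real.pi := by field_simp
      have hB : ‖∑ m ∈ Finset.Ico b n, qTerm (rootE n) 1 m‖ ≤
          C * ((1 + 1 / ε) * endDist n b ^ ε) := by
        rw [hd, Finset.sum_Ico_eq_sum_range, ← Finset.sum_range_reflect]
        calc _ ≤ ∑ j ∈ Finset.range (n - b), ‖qTerm (rootE n) 1 (b + (n - b - 1 - j))‖ :=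
              norm_sum_le _ _
          _ ≤ ∑ m ∈ Finset.range (n - b), C * ((m : ℝ) + 1)⁻¹ := by
              refine Finset.sum_le_sum fun m hm => ?_
              rw [Finset.mem_range] at hm
              refine (hb' n _ (by omega)).trans ?_
              refine mul_le_mul_of_nonneg_left (inv_anti₀ (by positivity) ?_) hC
              rw [endDist]
              have : m ≤ min (b + (n - b - 1 - m)) (n - (b + (n - b - 1 - m))) := by omega
              have : (m : ℝ) ≤ _ := Nat.cast_le.2 this
              linarith
          _ ≤ _ := by
              rw [← Finset.mul_sum]
              exact mul_le_mul_of_nonneg_left (sum_inv_succ_le hε _) hC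
      rw [hsplit]
      refine (norm_sub_le _ _).trans ?_
      rw [add_mul Real.pi, mul_assoc C]
      refine add_le_add (hA.trans ?_) hB
      exact le_mul_of_one_le_right Real.pi_pos.le h1

/-! ### Recursions in `n` and existence of the limits. -/

theorem strictAnti_cons_iff {r : ℕ} {a : ℕ} {f : Fin r → ℕ} :
    StrictAnti (Fin.cons a f : Fin (r + 1) → ℕ) ↔ (∀ i, f i < a) ∧ StrictAnti f := by
  constructor
  · intro h
    refine ⟨fun i => ?_, fun i j hij => ?_⟩
    · simpa using h (Fin.succ_pos i)
    · simpa using h (Fin.succ_lt_succ_iff.2 hij)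
  · rintro ⟨h1, h2⟩ i j hij
    induction i using Fin.cases with
    | zero =>
      induction j using Fin.cases with
      | zero => exact absurd hij (lt_irrefl _)
      | succ j => simpa using h1 j
    | succ i =>
      induction j using Fin.cases with
      | zero => exact absurd hij (Fin.not_lt_zero _)
      | succ j => simpa using h2 (Fin.succ_lt_succ_iff.1 hij)

theorem antitone_cons_iff {r : ℕ} {a : ℕ} {f : Fin r → ℕ} :
    Antitone (Fin.cons a f : Fin (r + 1) → ℕ) ↔ (∀ i, f i ≤ a) ∧ Antitone f := by
  constructor
  · intro h
    refine ⟨fun i => ?_, fun i j hij => ?_⟩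
    · simpa using h (Fin.zero_le i.succ)
    · simpa using h (Fin.succ_le_succ_iff.2 hij)
  · rintro ⟨h1, h2⟩ i j hij
    induction j using Fin.cases with
    | zero => rw [Fin.le_zero_iff.1 hij]
    | succ j =>
      induction i using Fin.cases with
      | zero => simpa using h1 j
      | succ i => simpa using h2 (Fin.succ_le_succ_iff.1 hij)

theorem summand_cons {r : ℕ} (k : Fin (r + 1) → ℕ) (q : ℂ) (a : ℕ) (m : Fin r → ℕ) :
    summand k q (Fin.cons a m) = qTerm q (k 0) a * summand (Fin.tail k) q m := by
  rw [summand, Fin.prod_univ_succ]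
  rfl

theorem z_depth_zero (n : ℕ) (k : Fin 0 → ℕ) (q : ℂ) : z n k q = 1 := by
  rw [z, Finset.filter_true_of_mem fun _ _ i => i.elim0]
  simp [summand]

theorem zStar_depth_zero (n : ℕ) (k : Fin 0 → ℕ) (q : ℂ) : zStar n k q = 1 := by
  rw [zStar, Finset.filter_true_of_mem fun _ _ i => i.elim0]
  simp [summand]

theorem z_zero {r : ℕ} (k : Fin (r + 1) → ℕ) (q : ℂ) : z 0 k q = 0 := by
  rw [z, Finset.sum_eq_zero]
  intro m hm
  rw [Finset.mem_filter, Fintype.mem_piFinset] at hm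
  simpa using hm.1 0

theorem zStar_zero {r : ℕ} (k : Fin (r + 1) → ℕ) (q : ℂ) : zStar 0 k q = 0 := by
  rw [zStar, Finset.sum_eq_zero]
  intro m hm
  rw [Finset.mem_filter, Fintype.mem_piFinset] at hm
  simpa using hm.1 0

/-- The sum is split according to whether the largest variable equals `b`. For `b = 0` nothing is in
range, in agreement with `qTerm_zero`. -/
theorem z_succ {r : ℕ} (b : ℕ) (k : Fin (r + 1) → ℕ) (hk : 1 ≤ k 0) (q : ℂ) :
    z (b + 1) k q = z b k q + qTerm q (k 0) b * z b (Fin.tail k) q := by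
  classical
  rcases Nat.eq_zero_or_pos b with rfl | hb
  · rw [qTerm_zero q hk, zero_mul, add_zero, z_zero, z, Finset.sum_eq_zero]
    intro m hm
    rw [Finset.mem_filter, Fintype.mem_piFinset] at hm
    have := hm.1 0
    rw [Finset.mem_Ioo] at this
    omega
  rw [z, ← Finset.sum_filter_not_add_sum_filter _ (fun m => m 0 = b)]
  congr 1
  · rw [z]
    refine Finset.sum_congr (Finset.ext fun m => ?_) fun _ _ => rfl
    simp only [Finset.mem_filter, Fintype.mem_piFinset, Finset.mem_Ioo]
    constructor
    · rintro ⟨⟨h1, h2⟩, h3⟩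
      refine ⟨fun i => ⟨(h1 i).1, ?_⟩, h2⟩
      have := h2.antitone (Fin.zero_le i)
      have := (h1 0).2
      omega
    · rintro ⟨h1, h2⟩
      exact ⟨⟨fun i => ⟨(h1 i).1, by have := (h1 i).2; omega⟩, h2⟩, (h1 0).2.ne⟩
  · rw [z, Finset.mul_sum]
    refine Finset.sum_nbij' Fin.tail (fun m => Fin.cons b m) ?_ ?_ ?_ ?_ ?_
    · intro m hm
      induction m using Fin.consCases with | _ a m => ?_
      simp only [Finset.mem_filter, Fintype.mem_piFinset, Finset.mem_Ioo, strictAnti_cons_iff,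
        Fin.forall_fin_succ, Fin.cons_zero, Fin.cons_succ, Fin.tail_cons] at hm ⊢
      obtain ⟨⟨h1, h2, h3⟩, rfl⟩ := hm
      exact ⟨fun i => ⟨(h1.2 i).1, h2 i⟩, h3⟩
    · intro m hm
      simp only [Finset.mem_filter, Fintype.mem_piFinset, Finset.mem_Ioo, strictAnti_cons_iff,
        Fin.forall_fin_succ, Fin.cons_zero, Fin.cons_succ] at hm ⊢
      exact ⟨⟨⟨⟨hb, by omega⟩, fun i => ⟨(hm.1 i).1, by have := (hm.1 i).2; omega⟩⟩,
        fun i => (hm.1 i).2, hm.2⟩, trivial⟩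
    · intro m hm
      rw [← (Finset.mem_filter.1 hm).2]
      exact Fin.cons_self_tail m
    · intro m _
      exact Fin.tail_cons _ _
    · intro m hm
      rw [← summand_cons, ← (Finset.mem_filter.1 hm).2, Fin.cons_self_tail]

/-- As for `z_succ`, but the later variables may equal `b` too, so the tail keeps the bound `b + 1`.
-/
theorem zStar_succ {r : ℕ} (b : ℕ) (k : Fin (r + 1) → ℕ) (hk : 1 ≤ k 0) (q : ℂ) :
    zStar (b + 1) k q = zStar b k q + qTerm q (k 0) b * zStar (b + 1) (Fin.tail k) q := by
  classical
  rcases Nat.eq_zero_or_pos b with rfl | hb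
  · rw [qTerm_zero q hk, zero_mul, add_zero, zStar_zero, zStar, Finset.sum_eq_zero]
    intro m hm
    rw [Finset.mem_filter, Fintype.mem_piFinset] at hm
    have := hm.1 0
    rw [Finset.mem_Ioo] at this
    omega
  rw [zStar, ← Finset.sum_filter_not_add_sum_filter _ (fun m => m 0 = b)]
  congr 1
  · rw [zStar]
    refine Finset.sum_congr (Finset.ext fun m => ?_) fun _ _ => rfl
    simp only [Finset.mem_filter, Fintype.mem_piFinset, Finset.mem_Ioo]
    constructor
    · rintro ⟨⟨h1, h2⟩, h3⟩
      refine ⟨fun i => ⟨(h1 i).1, ?_⟩, h2⟩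
      have := h2 (Fin.zero_le i)
      have := (h1 0).2
      omega
    · rintro ⟨h1, h2⟩
      exact ⟨⟨fun i => ⟨(h1 i).1, by have := (h1 i).2; omega⟩, h2⟩, (h1 0).2.ne⟩
  · rw [zStar, Finset.mul_sum]
    refine Finset.sum_nbij' Fin.tail (fun m => Fin.cons b m) ?_ ?_ ?_ ?_ ?_
    · intro m hm
      induction m using Fin.consCases with | _ a m => ?_
      simp only [Finset.mem_filter, Fintype.mem_piFinset, Finset.mem_Ioo, antitone_cons_iff,
        Fin.forall_fin_succ, Fin.cons_zero, Fin.cons_succ, Fin.tail_cons] at hm ⊢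
      obtain ⟨⟨h1, h2, h3⟩, rfl⟩ := hm
      exact ⟨h1.2, h3⟩
    · intro m hm
      simp only [Finset.mem_filter, Fintype.mem_piFinset, Finset.mem_Ioo, antitone_cons_iff,
        Fin.forall_fin_succ, Fin.cons_zero, Fin.cons_succ] at hm ⊢
      exact ⟨⟨⟨⟨hb, by omega⟩, hm.1⟩, fun i => by have := (hm.1 i).2; omega, hm.2⟩, trivial⟩
    · intro m hm
      rw [← (Finset.mem_filter.1 hm).2]
      exact Fin.cons_self_tail m
    · intro m _
      exact Fin.tail_cons _ _
    · intro m hm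
      rw [← summand_cons, ← (Finset.mem_filter.1 hm).2, Fin.cons_self_tail]

theorem z_eq_psum {r : ℕ} (k : Fin (r + 1) → ℕ) (hk : 1 ≤ k 0) :
    (fun n b => z b k (rootE n)) =
      psum ((fun n m => qTerm (rootE n) (k 0) m) * fun n b => z b (Fin.tail k) (rootE n)) := by
  ext n b
  induction b with
  | zero => simp [psum, z_zero]
  | succ b ih =>
    simp only [psum, Pi.mul_apply] at ih ⊢
    rw [Finset.sum_range_succ, z_succ b k hk, ih]

theorem zStar_eq_psum {r : ℕ} (k : Fin (r + 1) → ℕ) (hk : 1 ≤ k 0) :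
    (fun n b => zStar b k (rootE n)) =
      psum ((fun n m => qTerm (rootE n) (k 0) m) *
        fun n b => zStar (b + 1) (Fin.tail k) (rootE n)) := by
  ext n b
  induction b with
  | zero => simp [psum, zStar_zero]
  | succ b ih =>
    simp only [psum, Pi.mul_apply] at ih ⊢
    rw [Finset.sum_range_succ, zStar_succ b k hk, ih]

theorem ctrl_qTerm_neg_one {k : ℕ} (hk : 1 ≤ k) : Ctrl (-1) fun n m => qTerm (rootE n) k m :=
  (ctrl_qTerm hk).mono (by
    have : (1 : ℝ) ≤ k := by exact_mod_cast hk
    linarith)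

theorem nice_psum_qTerm_mul {k : ℕ} (hk : 1 ≤ k) {A : ℕ → ℕ → ℂ}
    (hA : Nice (fun n m => qTerm (rootE n) 1 m) A) :
    Nice (fun n m => qTerm (rootE n) 1 m) (psum ((fun n m => qTerm (rootE n) k m) * A)) := by
  rcases hk.eq_or_lt with rfl | h
  · exact nice_psum_mul (ctrl_qTerm_neg_one le_rfl) tame_psum_qTerm_one hA
  · refine nice_psum_of_ctrl (ctrl_qTerm_neg_one le_rfl) tame_psum_qTerm_one (s := -3 / 2)
      (by norm_num) ((ctrl_qTerm hk).mul_tame hA.tame ?_)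
    have : (2 : ℝ) ≤ k := by exact_mod_cast h
    linarith

theorem nice_z {r : ℕ} (k : Fin r → ℕ) (hk : ∀ a, 1 ≤ k a) :
    Nice (fun n m => qTerm (rootE n) 1 m) fun n b => z b k (rootE n) := by
  induction r with
  | zero =>
    simp only [z_depth_zero]
    exact nice_one tame_psum_qTerm_one
  | succ r ih =>
    rw [z_eq_psum k (hk 0)]
    exact nice_psum_qTerm_mul (hk 0) (ih (Fin.tail k) fun a => hk a.succ)

/-- The recursion involves the tail at `b + 1`, so the shift error `d` is carried along. It is a
`qTerm` times a tame sequence; the exponent `-3/4` lies above `-1`, and after multiplication by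
another `qTerm` it becomes summable. -/
theorem nice_zStar {r : ℕ} (k : Fin r → ℕ) (hk : ∀ a, 1 ≤ k a) :
    Nice (fun n m => qTerm (rootE n) 1 m) (fun n b => zStar b k (rootE n)) ∧
      ∃ d, Ctrl (-3 / 4) d ∧
        (fun n b => zStar (b + 1) k (rootE n)) = (fun n b => zStar b k (rootE n)) + d := by
  induction r with
  | zero =>
    simp only [zStar_depth_zero]
    refine ⟨nice_one tame_psum_qTerm_one, (fun _ _ => 0) * fun n m => qTerm (rootE n) 1 m,
      ((ctrl_qTerm_neg_one le_rfl).const_mul 0).mono (by norm_num), ?_⟩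
    ext n b
    simp
  | succ r ih =>
    obtain ⟨h1, d, hd, h2⟩ := ih (Fin.tail k) fun a => hk a.succ
    have hF := ctrl_qTerm_neg_one (hk 0)
    constructor
    · rw [zStar_eq_psum k (hk 0), h2, mul_add, psum_add]
      exact (nice_psum_qTerm_mul (hk 0) h1).add
        (nice_psum_of_ctrl (ctrl_qTerm_neg_one le_rfl) tame_psum_qTerm_one (by norm_num)
          (hF.mul hd))
    · refine ⟨(fun n m => qTerm (rootE n) (k 0) m) *
        fun n b => zStar (b + 1) (Fin.tail k) (rootE n), ?_, ?_⟩
      · refine hF.mul_tame ?_ (by norm_num)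
        rw [h2]
        exact h1.tame.add fun ε hε => hd.mono (by linarith)
      · ext n b
        exact zStar_succ b k (hk 0) (rootE n)

theorem tendsto_xi {r : ℕ} (k : Fin r → ℕ) (hk : ∀ a, 1 ≤ k a) :
    Tendsto (fun n : ℕ => z n k (rootE n)) atTop (𝓝 (xi k)) :=
  -- The right limit at distance `0` is the limit of the full sum, with second argument `n` itself.
  tendsto_nhds_limUnder ((((nice_z k hk).tame 1 one_pos).right 0))

theorem tendsto_xiStar {r : ℕ} (k : Fin r → ℕ) (hk : ∀ a, 1 ≤ k a) :
    Tendsto (fun n : ℕ => zStar n k (rootE n)) atTop (𝓝 (xiStar k)) :=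
  tendsto_nhds_limUnder ((((nice_zStar k hk).1.tame 1 one_pos).right 0))

/-! ### Generating series over indices, one monomial per entry. -/

/-- The exponent of the monomial `y` (for `k = 1`) or `x ^ (k - 2) * z` (for `k ≥ 2`). -/
noncomputable def letterExpo (k : ℕ) : Fin 3 →₀ ℕ :=
  if k = 1 then Finsupp.single 1 1 else Finsupp.single 0 (k - 2) + Finsupp.single 2 1

/-- The exponent attached to an index. -/
noncomputable def expo {r : ℕ} (k : Fin r → ℕ) : Fin 3 →₀ ℕ := ∑ i, letterExpo (k i)

theorem expo_one_add_expo_two {r : ℕ} (k : Fin r → ℕ) : expo k 1 + expo k 2 = r := by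
  rw [expo, Finsupp.finsetSum_apply, Finsupp.finsetSum_apply, ← Finset.sum_add_distrib]
  have : ∀ j, letterExpo j 1 + letterExpo j 2 = 1 := by
    intro j
    unfold letterExpo
    split_ifs <;> simp
  simp [this]

theorem height_eq_expo_two {r : ℕ} (k : Fin r → ℕ) (hk : ∀ i, 1 ≤ k i) :
    height k = expo k 2 := by
  rw [expo, Finsupp.finsetSum_apply, height, Finset.card_filter]
  refine Finset.sum_congr rfl fun i _ => ?_
  have := hk i
  unfold letterExpo
  split_ifs with h1 h2 h2
  · omega
  · simp
  · simp
  · omega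

theorem weight_eq_expo {r : ℕ} (k : Fin r → ℕ) (hk : ∀ i, 1 ≤ k i) :
    ∑ i, k i = expo k 0 + expo k 1 + 2 * expo k 2 := by
  simp only [expo, Finsupp.finsetSum_apply]
  rw [Finset.mul_sum, ← Finset.sum_add_distrib, ← Finset.sum_add_distrib]
  refine Finset.sum_congr rfl fun i _ => ?_
  have := hk i
  unfold letterExpo
  split_ifs with h
  · simp [h]
  · simp
    omega

theorem expo_eq_iff {r : ℕ} (k : Fin r → ℕ) (hk : ∀ i, 1 ≤ k i) (e : Fin 3 →₀ ℕ) :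
    expo k = e ↔ e 1 + e 2 = r ∧ ∑ i, k i = e 0 + e 1 + 2 * e 2 ∧ height k = e 2 := by
  have h1 := expo_one_add_expo_two k
  have h2 := height_eq_expo_two k hk
  have h3 := weight_eq_expo k hk
  constructor
  · rintro rfl
    exact ⟨h1, h3, h2⟩
  · rintro ⟨a, b, c⟩
    ext i
    fin_cases i <;> simp <;> omega

/-- The generating series over the indices of depth `r` with entries in `[1, K]`. -/
noncomputable def truncSum (K : ℕ) {r : ℕ} (f : (Fin r → ℕ) → ℂ) : Series :=
  ∑ k ∈ Fintype.piFinset fun _ : Fin r => Finset.Icc 1 K, MvPowerSeries.monomial (expo k) (f k)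

/-- The generating series over all indices of depth `r`. -/
noncomputable def depthPart {r : ℕ} (f : (Fin r → ℕ) → ℂ) : Series := fun e =>
  if e 1 + e 2 = r then ∑ k ∈ indexSet (e 0 + e 1 + 2 * e 2) r (e 2), f k else 0

theorem coeff_depthPart {r : ℕ} (f : (Fin r → ℕ) → ℂ) (e : Fin 3 →₀ ℕ) :
    MvPowerSeries.coeff e (depthPart f) =
      if e 1 + e 2 = r then ∑ k ∈ indexSet (e 0 + e 1 + 2 * e 2) r (e 2), f k else 0 := rfl

/-- Each coefficient is eventually constant: no entry of an index exceeds its weight, and the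
exponent determines the weight. -/
theorem tendsto_truncSum {r : ℕ} (f : (Fin r → ℕ) → ℂ) :
    Tendsto (fun K => truncSum K f) atTop (𝓝 (depthPart f)) := by
  classical
  rw [MvPowerSeries.WithPiTopology.tendsto_iff_coeff_tendsto]
  intro e
  refine tendsto_const_nhds.congr' ?_
  filter_upwards [eventually_ge_atTop (e 0 + e 1 + 2 * e 2)] with K hK
  rw [truncSum, map_sum]
  simp only [MvPowerSeries.coeff_monomial]
  rw [← Finset.sum_filter, coeff_depthPart]
  have key : ∀ k : Fin r → ℕ, (k ∈ Fintype.piFinset (fun _ : Fin r => Finset.Icc 1 K) ∧ e = expo k) ↔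
      e 1 + e 2 = r ∧ k ∈ indexSet (e 0 + e 1 + 2 * e 2) r (e 2) := by
    intro k
    rw [mem_indexSet, Fintype.mem_piFinset]
    simp only [Finset.mem_Icc]
    constructor
    · rintro ⟨h1, h2⟩
      obtain ⟨a, b, c⟩ := (expo_eq_iff k (fun i => (h1 i).1) e).1 h2.symm
      exact ⟨a, b, fun i => (h1 i).1, c⟩
    · rintro ⟨a, b, h1, c⟩
      refine ⟨fun i => ⟨h1 i, ?_⟩, ((expo_eq_iff k h1 e).2 ⟨a, b, c⟩).symm⟩
      exact (Finset.single_le_sum (fun _ _ => Nat.zero_le _) (Finset.mem_univ i)).trans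
        (b.trans_le hK)
  split_ifs with h
  · refine Finset.sum_congr (Finset.ext fun k => ?_) fun _ _ => rfl
    rw [Finset.mem_filter, key]
    simp [h]
  · refine (Finset.sum_eq_zero fun k hk => ?_).symm
    rw [Finset.mem_filter, key] at hk
    exact absurd hk.1 h

theorem depthPart_congr {r : ℕ} {f g : (Fin r → ℕ) → ℂ} (h : ∀ k, (∀ i, 1 ≤ k i) → f k = g k) :
    depthPart f = depthPart g := by
  ext e
  rw [coeff_depthPart, coeff_depthPart]
  split_ifs
  · exact Finset.sum_congr rfl fun k hk => h k (mem_indexSet.1 hk).2.1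
  · rfl

theorem depthPart_add {r : ℕ} (f g : (Fin r → ℕ) → ℂ) :
    depthPart (fun k => f k + g k) = depthPart f + depthPart g := by
  ext e
  rw [map_add, coeff_depthPart, coeff_depthPart, coeff_depthPart]
  split_ifs
  · exact Finset.sum_add_distrib
  · rw [add_zero]

theorem depthPart_zero (f : (Fin 0 → ℕ) → ℂ) : depthPart f = MvPowerSeries.C (f default) := by
  refine tendsto_nhds_unique (tendsto_truncSum f) (tendsto_const_nhds.congr fun K => ?_)
  have h : (fun a => isEmptyElim a : Fin 0 → ℕ) = default := Subsingleton.elim _ _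
  simp [truncSum, expo, MvPowerSeries.monomial_zero_eq_C_apply, ← h]
  rfl

theorem expo_cons {r : ℕ} (a : ℕ) (k : Fin r → ℕ) :
    expo (Fin.cons a k : Fin (r + 1) → ℕ) = letterExpo a + expo k := by
  simp [expo, Fin.sum_univ_succ]

theorem truncSum_cons (K : ℕ) {r : ℕ} (φ : ℕ → ℂ) (g : (Fin r → ℕ) → ℂ) :
    truncSum K (fun k : Fin (r + 1) → ℕ => φ (k 0) * g (Fin.tail k)) =
      (∑ a ∈ Finset.Icc 1 K, MvPowerSeries.monomial (letterExpo a) (φ a)) * truncSum K g := by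
  rw [truncSum, truncSum, Finset.sum_mul_sum, ← Finset.sum_product']
  refine Finset.sum_nbij' (fun k => (k 0, Fin.tail k)) (fun p => Fin.cons p.1 p.2) ?_ ?_ ?_ ?_ ?_
  · intro k hk
    rw [Fintype.mem_piFinset] at hk
    exact Finset.mem_product.2 ⟨hk 0, Fintype.mem_piFinset.2 fun i => hk i.succ⟩
  · intro p hp
    rw [Finset.mem_product, Fintype.mem_piFinset] at hp
    rw [Fintype.mem_piFinset, Fin.forall_fin_succ]
    exact ⟨hp.1, hp.2⟩
  · intro k _
    exact Fin.cons_self_tail k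
  · intro p _
    simp
  · intro k _
    rw [MvPowerSeries.monomial_mul_monomial, ← expo_cons, Fin.cons_self_tail]

/-- The series `ν y + w ν² z + w² ν³ x z + w³ ν⁴ x² z + ⋯`. -/
noncomputable def letterSeries (w ν : ℂ) : Series :=
  MvPowerSeries.C ν * vY +
    MvPowerSeries.C (w * ν ^ 2) * vZ * (1 - MvPowerSeries.C (w * ν) * vX)⁻¹

theorem constantCoeff_one_sub_C_mul_vX (c : ℂ) :
    MvPowerSeries.constantCoeff (1 - MvPowerSeries.C c * vX : Series) = 1 := by
  simp [vX]

theorem monomial_letterExpo (j : ℕ) (c : ℂ) :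
    (MvPowerSeries.monomial (letterExpo (j + 2)) c : Series) =
      MvPowerSeries.C c * vX ^ j * vZ := by
  rw [vX, vZ, MvPowerSeries.X_pow_eq, MvPowerSeries.X, ← MvPowerSeries.monomial_zero_eq_C_apply,
    MvPowerSeries.monomial_mul_monomial, MvPowerSeries.monomial_mul_monomial]
  simp [letterExpo]

theorem sum_letters (w ν : ℂ) (K : ℕ) :
    (∑ a ∈ Finset.Icc 1 (K + 1), MvPowerSeries.monomial (letterExpo a) (w ^ (a - 1) * ν ^ a) :
      Series) = MvPowerSeries.C ν * vY + MvPowerSeries.C (w * ν ^ 2) * vZ *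
        ((1 - (MvPowerSeries.C (w * ν) * vX) ^ K) * (1 - MvPowerSeries.C (w * ν) * vX)⁻¹) := by
  have hinv := MvPowerSeries.mul_inv_cancel (1 - MvPowerSeries.C (w * ν) * vX : Series)
    (by rw [constantCoeff_one_sub_C_mul_vX]; exact one_ne_zero)
  induction K with
  | zero =>
    rw [vY, MvPowerSeries.X, ← MvPowerSeries.monomial_zero_eq_C_apply,
      MvPowerSeries.monomial_mul_monomial]
    simp [letterExpo]
  | succ K ih =>
    rw [Finset.sum_Icc_succ_top (by omega), ih, monomial_letterExpo]
    have : (MvPowerSeries.C (w ^ (K + 1 + 1 - 1) * ν ^ (K + 1 + 1)) : Series) =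
        MvPowerSeries.C (w * ν ^ 2) * MvPowerSeries.C (w * ν) ^ K := by
      rw [← map_pow, ← map_mul, Nat.add_sub_cancel]
      congr 1
      ring
    rw [this, mul_pow, mul_pow]
    linear_combination (-MvPowerSeries.C (w * ν ^ 2) * MvPowerSeries.C (w * ν) ^ K *
      vX ^ K * vZ) * hinv

theorem tendsto_sum_letters (w ν : ℂ) :
    Tendsto (fun K => (∑ a ∈ Finset.Icc 1 K,
      MvPowerSeries.monomial (letterExpo a) (w ^ (a - 1) * ν ^ a) : Series)) atTop
      (𝓝 (letterSeries w ν)) := by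
  rw [← tendsto_add_atTop_iff_nat 1]
  simp only [sum_letters]
  have h : Tendsto (fun K => (MvPowerSeries.C (w * ν) * vX : Series) ^ K) atTop (𝓝 0) :=
    MvPowerSeries.WithPiTopology.isTopologicallyNilpotent_of_constantCoeff_zero (by simp [vX])
  have := (((tendsto_const_nhds (x := (1 : Series))).sub h).mul_const
    ((1 - MvPowerSeries.C (w * ν) * vX : Series)⁻¹)).const_mul
      (MvPowerSeries.C (w * ν ^ 2) * vZ : Series)
  have := this.const_add (MvPowerSeries.C ν * vY : Series)
  simpa [letterSeries] using this

/-- Exponents are additive over entries, so the truncated sums factor through the first entry; the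
limit is taken in both factors. -/
theorem depthPart_cons {r : ℕ} (w ν : ℂ) (g : (Fin r → ℕ) → ℂ) :
    depthPart (fun k : Fin (r + 1) → ℕ => w ^ (k 0 - 1) * ν ^ k 0 * g (Fin.tail k)) =
      letterSeries w ν * depthPart g := by
  refine tendsto_nhds_unique (tendsto_truncSum _)
    (((tendsto_sum_letters w ν).mul (tendsto_truncSum g)).congr fun K => ?_)
  rw [← truncSum_cons K fun a => w ^ (a - 1) * ν ^ a]

/-- The generating series over all indices. -/
noncomputable def allSeries (f : ∀ r : ℕ, (Fin r → ℕ) → ℂ) : Series := fun e =>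
  ∑ k ∈ indexSet (e 0 + e 1 + 2 * e 2) (e 1 + e 2) (e 2), f _ k

theorem hasSum_depthPart (f : ∀ r : ℕ, (Fin r → ℕ) → ℂ) :
    HasSum (fun r => depthPart (f r)) (allSeries f) := by
  rw [MvPowerSeries.WithPiTopology.hasSum_iff_hasSum_coeff]
  intro e
  have h : MvPowerSeries.coeff e (allSeries f) =
      MvPowerSeries.coeff e (depthPart (f (e 1 + e 2))) := by
    rw [coeff_depthPart, if_pos rfl]
    rfl
  rw [h]
  refine hasSum_single _ fun r hr => ?_
  rw [coeff_depthPart, if_neg hr.symm]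

/-- This transports `z_succ` and `zStar_succ` to generating series; `g` is `f` in the first case and
`h` in the second. -/
theorem allSeries_recursion {f g h : ∀ r : ℕ, (Fin r → ℕ) → ℂ} {w ν : ℂ}
    (h0 : h 0 default = f 0 default)
    (hs : ∀ (r : ℕ) (k : Fin (r + 1) → ℕ), (∀ i, 1 ≤ k i) →
      h (r + 1) k = f (r + 1) k + w ^ (k 0 - 1) * ν ^ k 0 * g r (Fin.tail k)) :
    allSeries h = allSeries f + letterSeries w ν * allSeries g := by
  have e1 := (hasSum_nat_add_iff' 1).2 (hasSum_depthPart h)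
  have e2 := ((hasSum_nat_add_iff' 1).2 (hasSum_depthPart f)).add
    ((hasSum_depthPart g).mul_left (letterSeries w ν))
  have key : ∀ r, depthPart (h (r + 1)) =
      depthPart (f (r + 1)) + letterSeries w ν * depthPart (g r) := by
    intro r
    rw [← depthPart_cons, ← depthPart_add]
    exact depthPart_congr (hs r)
  simp only [← key, Finset.sum_range_one, depthPart_zero] at e1 e2
  rw [h0] at e1
  have := e1.unique e2
  linear_combination this

theorem allSeries_eq_one {f : ∀ r : ℕ, (Fin r → ℕ) → ℂ} (h0 : f 0 default = 1)
    (hs : ∀ (r : ℕ) (k : Fin (r + 1) → ℕ), f (r + 1) k = 0) : allSeries f = 1 := by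
  refine (hasSum_depthPart f).unique ?_
  have h : depthPart (f 0) = 1 := by rw [depthPart_zero, h0, map_one]
  rw [← h]
  refine hasSum_single 0 fun r hr => ?_
  obtain ⟨r, rfl⟩ := Nat.exists_eq_succ_of_ne_zero hr
  ext e
  rw [coeff_depthPart]
  simp [hs]

/-! ### Product formulas at finite level. -/

theorem pow_weight_mul_qTerm {r : ℕ} (κ q : ℂ) (N : ℕ) (k : Fin (r + 1) → ℕ) (c : ℂ) :
    κ ^ (∑ i, k i) * (qTerm q (k 0) N * c) =
      (q ^ N) ^ (k 0 - 1) * (κ / qInt q N) ^ k 0 * (κ ^ (∑ i, Fin.tail k i) * c) := by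
  rw [Fin.sum_univ_succ, pow_add, qTerm, div_pow, ← pow_mul, mul_comm N]
  simp only [Fin.tail]
  ring

/-- The generating series of the numbers `κ ^ |𝐤| * z_N(𝐤; q)`. -/
noncomputable def zSeries (κ q : ℂ) (N : ℕ) : Series :=
  allSeries fun _ k => κ ^ (∑ i, k i) * z N k q

/-- The generating series of the numbers `κ ^ |𝐤| * z⋆_N(𝐤; q)`. -/
noncomputable def zStarSeries (κ q : ℂ) (N : ℕ) : Series :=
  allSeries fun _ k => κ ^ (∑ i, k i) * zStar N k q

theorem zSeries_eq_prod (κ q : ℂ) (N : ℕ) :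
    zSeries κ q N = ∏ m ∈ Finset.range N, (1 + letterSeries (q ^ m) (κ / qInt q m)) := by
  induction N with
  | zero =>
    rw [Finset.prod_range_zero]
    refine allSeries_eq_one ?_ fun r k => ?_
    · simp [z_depth_zero]
    · rw [z_zero, mul_zero]
  | succ N ih =>
    rw [Finset.prod_range_succ, ← ih, mul_add, mul_one, mul_comm]
    refine allSeries_recursion ?_ fun r k hk => ?_
    · simp [z_depth_zero]
    · rw [z_succ N k (hk 0), mul_add, pow_weight_mul_qTerm]

theorem zStarSeries_mul_prod (κ q : ℂ) (N : ℕ) :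
    zStarSeries κ q N * ∏ m ∈ Finset.range N, (1 - letterSeries (q ^ m) (κ / qInt q m)) = 1 := by
  induction N with
  | zero =>
    rw [Finset.prod_range_zero, mul_one]
    refine allSeries_eq_one ?_ fun r k => ?_
    · simp [zStar_depth_zero]
    · rw [zStar_zero, mul_zero]
  | succ N ih =>
    have h : zStarSeries κ q (N + 1) = zStarSeries κ q N +
        letterSeries (q ^ N) (κ / qInt q N) * zStarSeries κ q (N + 1) := by
      refine allSeries_recursion ?_ fun r k hk => ?_
      · simp [zStar_depth_zero]
      · rw [zStar_succ N k (hk 0), mul_add, pow_weight_mul_qTerm]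
    rw [Finset.prod_range_succ]
    linear_combination ih + (∏ m ∈ Finset.range N, (1 - letterSeries (q ^ m) (κ / qInt q m))) * h

/-! ### Closed form of the product over roots of unity. -/

theorem prod_range_sub_primitiveRoot_pow_mul {R : Type*} [CommRing R] [IsDomain R] {ζ : R} {n : ℕ}
    (hn : 0 < n) (hζ : IsPrimitiveRoot ζ n) (a b : R) :
    ∏ m ∈ Finset.range n, (a - ζ ^ m * b) = a ^ n - b ^ n := by
  rw [hζ.pow_sub_pow_eq_prod_sub_mul a b hn]
  refine Finset.prod_nbij (fun m => ζ ^ m) ?_ ?_ ?_ fun _ _ => rfl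
  · intro m _
    rw [Polynomial.mem_nthRootsFinset hn, ← pow_mul, mul_comm, pow_mul, hζ.pow_eq_one, one_pow]
  · intro i hi j hj hij
    exact hζ.pow_inj (Finset.mem_range.1 hi) (Finset.mem_range.1 hj) hij
  · intro x hx
    have : NeZero n := ⟨hn.ne'⟩
    obtain ⟨i, hi, h⟩ := hζ.eq_pow_of_pow_eq_one ((Polynomial.mem_nthRootsFinset hn _).1 hx)
    exact ⟨i, Finset.mem_coe.2 (Finset.mem_range.2 hi), h⟩

theorem sum_range_two_mul {M : Type*} [AddCommMonoid M] (f : ℕ → M) (N : ℕ) :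
    ∑ j ∈ Finset.range (2 * N), f j = ∑ i ∈ Finset.range N, (f (2 * i) + f (2 * i + 1)) := by
  induction N with
  | zero => simp
  | succ N ih =>
    rw [Finset.sum_range_succ, ← ih, show 2 * (N + 1) = 2 * N + 1 + 1 by ring,
      Finset.sum_range_succ, Finset.sum_range_succ, add_assoc]

/-- The polynomial in `h` and `W` with value `(h + √W) ^ n + (h - √W) ^ n`. -/
def conjPowSum {R : Type*} [CommRing R] (n : ℕ) (h W : R) : R :=
  ∑ i ∈ Finset.range (n + 1), 2 * (n.choose (2 * i) : R) * h ^ (n - 2 * i) * W ^ i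

theorem add_pow_add_sub_pow {R : Type*} [CommRing R] (n : ℕ) (h δ : R) :
    (h + δ) ^ n + (h - δ) ^ n = conjPowSum n h (δ ^ 2) := by
  have key : ∀ x : R, (h + x) ^ n =
      ∑ j ∈ Finset.range (2 * (n + 1)), x ^ j * h ^ (n - j) * (n.choose j : R) := by
    intro x
    rw [add_comm h x, add_pow]
    refine Finset.sum_subset (Finset.range_subset_range.2 (by omega)) fun j _ hj => ?_
    rw [Finset.mem_range] at hj
    rw [Nat.choose_eq_zero_of_lt (by omega), Nat.cast_zero, mul_zero]
  rw [sub_eq_add_neg, key, key, sum_range_two_mul, sum_range_two_mul, ← Finset.sum_add_distrib,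
    conjPowSum]
  refine Finset.sum_congr rfl fun i _ => ?_
  rw [Even.neg_pow ⟨i, two_mul i⟩, Odd.neg_pow ⟨i, rfl⟩, ← pow_mul]
  ring

theorem map_conjPowSum {R S : Type*} [CommRing R] [CommRing S] (f : R →+* S) (n : ℕ) (h W : R) :
    f (conjPowSum n h W) = conjPowSum n (f h) (f W) := by
  simp [conjPowSum, map_ofNat]

/-- Over an algebraic closure, with `δ² = h² - ab`, one has `b (a - 2hζ + bζ²) = (h + δ - bζ)(h - δ
- bζ)`, and the product of each linear factor over the roots of unity is known. The result is even
in `δ`, so it lives in `R`. -/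
theorem prod_quadratic_primitiveRoot {R : Type*} [CommRing R] [IsDomain R] {ζ : R} {n : ℕ}
    (hn : 0 < n) (hζ : IsPrimitiveRoot ζ n) {a b h : R} (hb : b ≠ 0) :
    ∏ m ∈ Finset.range n, (a - 2 * h * ζ ^ m + b * (ζ ^ m) ^ 2) =
      a ^ n + b ^ n - conjPowSum n h (h ^ 2 - a * b) := by
  let K := AlgebraicClosure (FractionRing R)
  let f : R →+* K := (algebraMap (FractionRing R) K).comp (algebraMap R (FractionRing R))
  have hf : Function.Injective f :=
    (algebraMap (FractionRing R) K).injective.comp (IsFractionRing.injective R (FractionRing R))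
  have hζ' : IsPrimitiveRoot (f ζ) n := hζ.map_of_injective hf
  have hb' : f b ≠ 0 := (map_ne_zero_iff f hf).2 hb
  obtain ⟨δ, hδ⟩ := IsAlgClosed.exists_pow_nat_eq (f (h ^ 2 - a * b)) (n := 2) two_pos
  apply hf
  rw [map_prod, map_sub, map_conjPowSum, ← hδ, ← add_pow_add_sub_pow]
  apply mul_left_cancel₀ (pow_ne_zero n hb')
  have e1 := prod_range_sub_primitiveRoot_pow_mul hn hζ' (f h + δ) (f b)
  have e2 := prod_range_sub_primitiveRoot_pow_mul hn hζ' (f h - δ) (f b)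
  have hAB : (f h + δ) * (f h - δ) = f a * f b := by
    rw [map_sub, map_pow, map_mul] at hδ
    linear_combination -hδ
  calc f b ^ n * ∏ m ∈ Finset.range n, f (a - 2 * h * ζ ^ m + b * (ζ ^ m) ^ 2)
      = ∏ m ∈ Finset.range n, (((f h + δ) - f ζ ^ m * f b) * ((f h - δ) - f ζ ^ m * f b)) := by
        conv_lhs => rw [← Finset.card_range n, ← Finset.prod_const, Finset.card_range,
          ← Finset.prod_mul_distrib]
        refine Finset.prod_congr rfl fun m _ => ?_
        simp only [map_add, map_sub, map_mul, map_pow, map_ofNat]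
        linear_combination -hAB
    _ = (f h + δ) ^ n * (f h - δ) ^ n - f b ^ n * ((f h + δ) ^ n + (f h - δ) ^ n) +
          f b ^ n * f b ^ n := by
        rw [Finset.prod_mul_distrib, e1, e2]
        ring
    _ = _ := by
        rw [← mul_pow, hAB, mul_pow, map_add, map_pow, map_pow]
        ring

/-- Clearing the denominators `1 - w` and `1 - wνx` makes the factor quadratic in `w`, with
coefficients that depend on `w = q^m` no further. -/
theorem letterSeries_factor (ε κ q w ν : ℂ) (hν : ν * (1 - w) = κ * (1 - q)) :
    (1 + MvPowerSeries.C ε * letterSeries w ν) * MvPowerSeries.C (1 - w) *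
        (1 - MvPowerSeries.C w * (1 + MvPowerSeries.C (κ * (1 - q)) * vX)) =
      (1 + MvPowerSeries.C (ε * (κ * (1 - q))) * vY - MvPowerSeries.C w) *
          (1 - MvPowerSeries.C w * (1 + MvPowerSeries.C (κ * (1 - q)) * vX)) +
        MvPowerSeries.C (ε * (κ * (1 - q)) ^ 2) * vZ * MvPowerSeries.C w := by
  have hinv := MvPowerSeries.mul_inv_cancel (1 - MvPowerSeries.C (w * ν) * vX : Series)
    (by rw [constantCoeff_one_sub_C_mul_vX]; exact one_ne_zero)
  rw [← hν, letterSeries]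
  generalize (1 - MvPowerSeries.C (w * ν) * vX : Series)⁻¹ = u at hinv ⊢
  simp only [map_mul, map_pow, map_sub, map_one] at hinv ⊢
  generalize (MvPowerSeries.C w : Series) = w' at *
  generalize (MvPowerSeries.C ν : Series) = ν' at *
  generalize (MvPowerSeries.C ε : Series) = ε' at *
  linear_combination (ε' * w' * ν' ^ 2 * vZ * (1 - w') ^ 2) * hinv

instance : IsDomain Series := NoZeroDivisors.to_isDomain _

/-- The closed form of the product of the series attached to the nontrivial roots of unity. -/
theorem prod_letterSeries {n : ℕ} (hn : 0 < n) {q : ℂ} (hq : IsPrimitiveRoot q n) (ε κ : ℂ)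
    {X Y Z h : Series} (hX : X = MvPowerSeries.C (κ * (1 - q)) * vX)
    (hY : Y = MvPowerSeries.C (ε * (κ * (1 - q))) * vY)
    (hZ : Z = MvPowerSeries.C (ε * (κ * (1 - q)) ^ 2) * vZ)
    (hh : 2 * h = 1 + (1 + X) * (1 + Y) - Z) :
    (∏ m ∈ Finset.range n, (1 + MvPowerSeries.C ε * letterSeries (q ^ m) (κ / qInt q m))) *
        n * ((1 + X) ^ n - 1) * (Z - X * Y) =
      X * ((1 + X) ^ n + (1 + Y) ^ n - conjPowSum n h (h ^ 2 - (1 + Y) * (1 + X))) := by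
  have hC : Function.Injective (MvPowerSeries.C (σ := Fin 3) (R := ℂ)) := MvPowerSeries.C_injective
  have hq' : IsPrimitiveRoot (MvPowerSeries.C q : Series) n := hq.map_of_injective hC
  have hb : (1 + X : Series) ≠ 0 := by
    intro h0
    have := congrArg MvPowerSeries.constantCoeff h0
    simp [hX, vX] at this
  -- Both products run over all `n`-th roots of unity. Their factors at `m = 0` are `-X` and `1 + Y
  -- - 2h + 1 + X = Z - XY`, which explains these terms in the closed form.
  have hX1 := prod_range_sub_primitiveRoot_pow_mul hn hq' 1 (1 + X)
  have hg := prod_quadratic_primitiveRoot hn hq' (a := 1 + Y) (h := h) hb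
  obtain ⟨N, rfl⟩ : ∃ N, n = N + 1 := ⟨n - 1, by omega⟩
  have hD := hq.prod_one_sub_pow_eq_order
  have hD' : ∏ m ∈ Finset.range N, (MvPowerSeries.C (1 - q ^ (m + 1)) : Series) =
      ((N + 1 : ℕ) : Series) := by
    rw [← map_prod, hD]
    simp
  have hprod : ∏ m ∈ Finset.range N, ((1 + MvPowerSeries.C ε *
        letterSeries (q ^ (m + 1)) (κ / qInt q (m + 1))) * MvPowerSeries.C (1 - q ^ (m + 1)) *
          (1 - MvPowerSeries.C q ^ (m + 1) * (1 + X))) =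
      ∏ m ∈ Finset.range N, (1 + Y - 2 * h * MvPowerSeries.C q ^ (m + 1) +
        (1 + X) * (MvPowerSeries.C q ^ (m + 1)) ^ 2) := by
    refine Finset.prod_congr rfl fun m hm => ?_
    rw [Finset.mem_range] at hm
    have hw : 1 - q ^ (m + 1) ≠ 0 :=
      sub_ne_zero.2 (hq.pow_ne_one_of_pos_of_lt (by omega) (by omega)).symm
    have hν : κ / qInt q (m + 1) * (1 - q ^ (m + 1)) = κ * (1 - q) := by
      rw [qInt]
      rcases eq_or_ne (1 - q) 0 with h0 | h0
      · simp [h0]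
      · field_simp
    have := letterSeries_factor ε κ q (q ^ (m + 1)) _ hν
    rw [← hX, ← hY, ← hZ, map_pow] at this
    rw [this, hh]
    ring
  rw [Finset.prod_mul_distrib, Finset.prod_mul_distrib, hD'] at hprod
  rw [Finset.prod_range_succ'] at hX1 hg ⊢
  rw [← hprod] at hg
  -- Division by `qInt q 0 = 0` gives `0`, so the factor at `m = 0` is 1.
  have h0 : letterSeries (q ^ 0) (κ / qInt q 0) = 0 := by
    simp [letterSeries, qInt_zero]
  rw [h0, mul_zero, add_zero, mul_one]
  simp only [pow_zero, one_mul, one_pow, mul_one] at hX1 hg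
  rw [hh] at hg
  rw [add_comm ((1 + X) ^ (N + 1)) ((1 + Y) ^ (N + 1)), ← hg]
  linear_combination ((∏ m ∈ Finset.range N, (1 + MvPowerSeries.C ε *
    letterSeries (q ^ (m + 1)) (κ / qInt q (m + 1)))) * ((N + 1 : ℕ) : Series) *
      (Z - X * Y)) * hX1

/-! ### Limits of power series: exponential and hyperbolic cosine. -/

theorem coeff_pow_mul_eq_zero {τ : Series} (hτ : MvPowerSeries.constantCoeff τ = 0) (h : Series)
    {e : Fin 3 →₀ ℕ} {i : ℕ} (hi : e.degree < i) : MvPowerSeries.coeff e (τ ^ i * h) = 0 := by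
  refine MvPowerSeries.coeff_of_lt_order (lt_of_lt_of_le (Nat.cast_lt.2 hi) ?_)
  refine (MvPowerSeries.le_order_pow_of_constantCoeff_eq_zero i hτ).trans ?_
  exact le_trans le_self_add MvPowerSeries.le_order_mul

theorem coeff_subst_eq_sum {τ : Series} (hτ : MvPowerSeries.constantCoeff τ = 0)
    (f : PowerSeries ℂ) (e : Fin 3 →₀ ℕ) :
    MvPowerSeries.coeff e (f.subst τ) = ∑ i ∈ Finset.range (e.degree + 1),
      PowerSeries.coeff i f * MvPowerSeries.coeff e (τ ^ i) := by
  rw [PowerSeries.coeff_subst (PowerSeries.HasSubst.of_constantCoeff_zero hτ)]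
  simp only [smul_eq_mul]
  refine finsum_eq_sum_of_support_subset _ fun i hi => ?_
  rw [Finset.coe_range, Set.mem_Iio]
  by_contra hlt
  apply hi
  have := coeff_pow_mul_eq_zero hτ 1 (e := e) (i := i) (by omega)
  rw [mul_one] at this
  simp [this]

theorem hasSum_subst {τ : Series} (hτ : MvPowerSeries.constantCoeff τ = 0) (f : PowerSeries ℂ) :
    HasSum (fun i => MvPowerSeries.C (PowerSeries.coeff i f) * τ ^ i) (f.subst τ) := by
  rw [MvPowerSeries.WithPiTopology.hasSum_iff_hasSum_coeff]
  intro e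
  rw [coeff_subst_eq_sum hτ]
  simp only [MvPowerSeries.coeff_C_mul]
  refine hasSum_sum_of_ne_finset_zero fun i hi => ?_
  rw [Finset.mem_range] at hi
  have := coeff_pow_mul_eq_zero hτ 1 (e := e) (i := i) (by omega)
  rw [mul_one] at this
  rw [this, mul_zero]

/-- Termwise limits of truncated power series in a varying series without constant term. -/
theorem tendsto_sum_pow_mul {τ : ℕ → Series} {τ₀ : Series}
    (hτ : ∀ n, MvPowerSeries.constantCoeff (τ n) = 0) (hlim : Tendsto τ atTop (𝓝 τ₀))
    {f : PowerSeries ℂ} {b : ℕ → ℕ → ℂ}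
    (hb : ∀ i, Tendsto (fun n => b n i) atTop (𝓝 (PowerSeries.coeff i f)))
    {H : ℕ → ℕ → Series} {H₀ : Series} (hH : ∀ i, Tendsto (fun n => H n i) atTop (𝓝 H₀))
    {N : ℕ → ℕ} (hN : Tendsto N atTop atTop) :
    Tendsto (fun n => ∑ i ∈ Finset.range (N n), MvPowerSeries.C (b n i) * (τ n ^ i * H n i)) atTop
      (𝓝 (f.subst τ₀ * H₀)) := by
  have hτ₀ : MvPowerSeries.constantCoeff τ₀ = 0 := by
    have h := ((MvPowerSeries.WithPiTopology.continuous_constantCoeff ℂ).tendsto τ₀).comp hlim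
    exact tendsto_nhds_unique h (tendsto_const_nhds.congr fun n => (hτ n).symm)
  -- Only the terms with `i` at most the degree of `e` contribute to the coefficient at `e`, so
  -- termwise limits of finitely many terms suffice.
  rw [MvPowerSeries.WithPiTopology.tendsto_iff_coeff_tendsto]
  intro e
  have hs := MvPowerSeries.WithPiTopology.hasSum_iff_hasSum_coeff.1
    ((hasSum_subst hτ₀ f).mul_right H₀) e
  have hfin : HasSum (fun i => MvPowerSeries.coeff e
      (MvPowerSeries.C (PowerSeries.coeff i f) * τ₀ ^ i * H₀))
      (∑ i ∈ Finset.range (e.degree + 1), MvPowerSeries.coeff e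
        (MvPowerSeries.C (PowerSeries.coeff i f) * τ₀ ^ i * H₀)) := by
    refine hasSum_sum_of_ne_finset_zero fun i hi => ?_
    rw [Finset.mem_range] at hi
    rw [mul_assoc, MvPowerSeries.coeff_C_mul, coeff_pow_mul_eq_zero hτ₀ _ (by omega), mul_zero]
  rw [hs.unique hfin]
  have hlim' : Tendsto (fun n => ∑ i ∈ Finset.range (e.degree + 1), MvPowerSeries.coeff e
      (MvPowerSeries.C (b n i) * τ n ^ i * H n i)) atTop (𝓝 (∑ i ∈ Finset.range (e.degree + 1),
        MvPowerSeries.coeff e (MvPowerSeries.C (PowerSeries.coeff i f) * τ₀ ^ i * H₀))) := by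
    refine tendsto_finsetSum _ fun i _ => ?_
    refine ((MvPowerSeries.WithPiTopology.continuous_coeff ℂ e).tendsto _).comp ?_
    exact (((MvPowerSeries.WithPiTopology.continuous_C.tendsto _).comp (hb i)).mul
      (hlim.pow i)).mul (hH i)
  refine hlim'.congr' ?_
  filter_upwards [hN.eventually_ge_atTop (e.degree + 1)] with n hn
  rw [map_sum]
  simp only [← mul_assoc]
  refine Finset.sum_subset (Finset.range_subset_range.2 hn) fun i _ hi => ?_
  rw [Finset.mem_range] at hi
  rw [mul_assoc, MvPowerSeries.coeff_C_mul, coeff_pow_mul_eq_zero (hτ n) _ (by omega), mul_zero]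

theorem tendsto_choose_div_pow (j i : ℕ) :
    Tendsto (fun n : ℕ => (((n - j).choose i : ℕ) : ℂ) / (n : ℂ) ^ i) atTop
      (𝓝 (1 / (i.factorial : ℂ))) := by
  induction i with
  | zero => simp
  | succ i ih =>
    have h1 : Tendsto (fun n : ℕ => ((n : ℂ) - ((j + i : ℕ) : ℂ)) / n) atTop (𝓝 1) := by
      have h := (tendsto_const_nhds (x := (1 : ℂ))).sub
        (tendsto_const_div_atTop_nhds_zero_nat ((j + i : ℕ) : ℂ))
      rw [sub_zero] at h
      refine h.congr' ?_
      filter_upwards [eventually_ne_atTop 0] with n hn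
      have : (n : ℂ) ≠ 0 := Nat.cast_ne_zero.2 hn
      field_simp
    have h2 := (ih.mul h1).div_const ((i + 1 : ℕ) : ℂ)
    rw [mul_one, div_div, ← Nat.cast_mul, mul_comm i.factorial, ← Nat.factorial_succ] at h2
    refine h2.congr' ?_
    filter_upwards [eventually_ge_atTop (j + i), eventually_ne_atTop 0] with n hn hn0
    have hn' : (n : ℂ) ≠ 0 := Nat.cast_ne_zero.2 hn0
    have hi : ((i + 1 : ℕ) : ℂ) ≠ 0 := Nat.cast_ne_zero.2 (Nat.succ_ne_zero i)
    have e := congrArg (Nat.cast (R := ℂ)) (Nat.choose_succ_right_eq (n - j) i)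
    rw [Nat.cast_mul, Nat.cast_mul, Nat.sub_sub, Nat.cast_sub hn] at e
    rw [← eq_div_iff hi] at e
    rw [e]
    field_simp
    ring

theorem C_natCast (n : ℕ) : (MvPowerSeries.C (n : ℂ) : Series) = n := map_natCast _ n

theorem C_div_pow_mul {n : ℕ} (hn : n ≠ 0) (c : ℂ) (i : ℕ) (σ : Series) :
    MvPowerSeries.C (c / (n : ℂ) ^ i) * ((n : Series) * σ) ^ i = MvPowerSeries.C c * σ ^ i := by
  have hn' : (n : ℂ) ≠ 0 := Nat.cast_ne_zero.2 hn
  rw [mul_pow, ← C_natCast, ← map_pow, ← mul_assoc, ← map_mul, div_mul_cancel₀ _ (pow_ne_zero _ hn')]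

theorem tendsto_one_add_pow {σ : ℕ → Series} {τ : Series}
    (hσ : ∀ n, MvPowerSeries.constantCoeff (σ n) = 0)
    (hlim : Tendsto (fun n : ℕ => (n : Series) * σ n) atTop (𝓝 τ)) (j : ℕ) :
    Tendsto (fun n : ℕ => (1 + σ n) ^ (n - j)) atTop (𝓝 (sExp τ)) := by
  have h := tendsto_sum_pow_mul (τ := fun n : ℕ => (n : Series) * σ n) (fun n => by simp [hσ n]) hlim
    (f := PowerSeries.exp ℂ) (b := fun n i => (((n - j).choose i : ℕ) : ℂ) / (n : ℂ) ^ i)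
    (fun i => by simpa [PowerSeries.coeff_exp] using tendsto_choose_div_pow j i)
    (H := fun _ _ => 1) (H₀ := 1) (fun _ => tendsto_const_nhds) (N := fun n => n - j + 1)
    ((tendsto_add_atTop_nat 1).comp (tendsto_sub_atTop_nat j))
  rw [mul_one] at h
  refine h.congr' ?_
  filter_upwards [eventually_ne_atTop 0] with n hn
  rw [add_comm 1, add_pow]
  refine Finset.sum_congr rfl fun i _ => ?_
  rw [mul_one, C_div_pow_mul hn, C_natCast, one_pow, mul_one, mul_comm]

/-- The product `(1 + a/n)(1 + b/n)` is `1 + (a + b)/n + ab/n²`, and the last term does not affect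
the limit of the `n`-th power. -/
theorem sExp_add {a b : Series} (ha : MvPowerSeries.constantCoeff a = 0)
    (hb : MvPowerSeries.constantCoeff b = 0) : sExp (a + b) = sExp a * sExp b := by
  have hinv : Tendsto (fun n : ℕ => (MvPowerSeries.C (1 / (n : ℂ)) : Series)) atTop (𝓝 0) := by
    have := (MvPowerSeries.WithPiTopology.continuous_C (σ := Fin 3) (R := ℂ)).tendsto 0
    rw [map_zero] at this
    exact this.comp (tendsto_const_div_atTop_nhds_zero_nat 1)
  have hn : ∀ᶠ n : ℕ in atTop, (n : Series) * MvPowerSeries.C (1 / (n : ℂ)) = 1 := by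
    filter_upwards [eventually_ne_atTop 0] with n hn
    rw [← C_natCast, ← map_mul, mul_one_div_cancel (Nat.cast_ne_zero.2 hn), map_one]
  have key : ∀ c : Series, MvPowerSeries.constantCoeff c = 0 →
      Tendsto (fun n : ℕ => (1 + MvPowerSeries.C (1 / (n : ℂ)) * c) ^ n) atTop (𝓝 (sExp c)) := by
    intro c hc
    refine tendsto_one_add_pow (fun n => by simp [hc]) ?_ 0
    refine tendsto_const_nhds.congr' ?_
    filter_upwards [hn] with n hn
    rw [← mul_assoc, hn, one_mul]
  have h2 : Tendsto (fun n : ℕ => (1 + (MvPowerSeries.C (1 / (n : ℂ)) * (a + b) +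
      MvPowerSeries.C (1 / (n : ℂ)) ^ 2 * (a * b))) ^ n) atTop (𝓝 (sExp (a + b))) := by
    refine tendsto_one_add_pow (fun n => by simp [ha, hb]) ?_ 0
    have h := (hinv.mul_const (a * b)).const_add (a + b)
    rw [zero_mul, add_zero] at h
    refine h.congr' ?_
    filter_upwards [hn] with n hn
    linear_combination (-(a + b) - MvPowerSeries.C (1 / (n : ℂ)) * (a * b)) * hn
  refine tendsto_nhds_unique h2 (((key a ha).mul (key b hb)).congr fun n => ?_)
  rw [← mul_pow]
  congr 1
  ring

/-- Termwise, `choose n (2i) W^i` tends to `ω^i / (2i)!` and `(1 + σ)^(n - 2i)` to the exponential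
of `τ`. -/
theorem tendsto_conjPowSum {σ W : ℕ → Series} {τ ω : Series}
    (hσ : ∀ n, MvPowerSeries.constantCoeff (σ n) = 0)
    (hW : ∀ n, MvPowerSeries.constantCoeff (W n) = 0)
    (hlim : Tendsto (fun n : ℕ => (n : Series) * σ n) atTop (𝓝 τ))
    (hlimW : Tendsto (fun n : ℕ => (n : Series) ^ 2 * W n) atTop (𝓝 ω)) :
    Tendsto (fun n : ℕ => conjPowSum n (1 + σ n) (W n)) atTop (𝓝 (2 * (sCoshSqrt ω * sExp τ))) := by
  have h := tendsto_sum_pow_mul (τ := fun n : ℕ => (n : Series) ^ 2 * W n) (fun n => by simp [hW n])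
    hlimW (f := PowerSeries.mk fun j : ℕ => (1 / ((2 * j).factorial : ℂ)))
    (b := fun n i => ((n.choose (2 * i) : ℕ) : ℂ) / (n : ℂ) ^ (2 * i))
    (fun i => by simpa using tendsto_choose_div_pow 0 (2 * i))
    (H := fun n i => (1 + σ n) ^ (n - 2 * i)) (fun i => tendsto_one_add_pow hσ hlim (2 * i))
    (tendsto_add_atTop_nat 1)
  refine (h.const_mul 2).congr' ?_
  filter_upwards [eventually_ne_atTop 0] with n hn
  have hn' : (n : ℂ) ≠ 0 := Nat.cast_ne_zero.2 hn
  rw [conjPowSum, Finset.mul_sum]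
  refine Finset.sum_congr rfl fun i _ => ?_
  have e : (MvPowerSeries.C (((n.choose (2 * i) : ℕ) : ℂ) / (n : ℂ) ^ (2 * i)) : Series) *
      (n : Series) ^ (2 * i) = (n.choose (2 * i) : Series) := by
    rw [← C_natCast n, ← map_pow, ← map_mul, div_mul_cancel₀ _ (pow_ne_zero _ hn'), C_natCast]
  rw [mul_pow, ← pow_mul]
  linear_combination 2 * W n ^ i * (1 + σ n) ^ (n - 2 * i) * e

/-! ### Passage to the limit in the product formulas. -/

theorem coeff_allSeries (f : ∀ r : ℕ, (Fin r → ℕ) → ℂ) (e : Fin 3 →₀ ℕ) {r : ℕ}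
    (hr : e 1 + e 2 = r) :
    MvPowerSeries.coeff e (allSeries f) = MvPowerSeries.coeff e (depthPart (f r)) := by
  subst hr
  rw [coeff_depthPart, if_pos rfl]
  rfl

theorem genSeries_eq_allSeries (f : ∀ {r : ℕ}, (Fin r → ℕ) → ℂ) (h0 : f (default : Fin 0 → ℕ) = 1) :
    genSeries f = allSeries fun _ k => ((-2 * Real.pi * Complex.I : ℂ)⁻¹) ^ (∑ i, k i) * f k := by
  ext e
  have h : MvPowerSeries.coeff e (genSum f) = if 1 ≤ e 1 + e 2 then
      ((-2 * Real.pi * Complex.I : ℂ) ^ (e 0 + e 1 + 2 * e 2))⁻¹ *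
        ∑ k ∈ indexSet (e 0 + e 1 + 2 * e 2) (e 1 + e 2) (e 2), f k else 0 := rfl
  rw [genSeries, map_add, h]
  rcases Nat.eq_zero_or_pos (e 1 + e 2) with h1 | h1
  · rw [if_neg (by omega), coeff_allSeries _ e h1, depthPart_zero, h0]
    simp
  · have he : e ≠ 0 := by
      rintro rfl
      simp at h1
    rw [if_pos (Nat.succ_le_of_lt h1), MvPowerSeries.coeff_one, if_neg he, zero_add, coeff_allSeries _ e rfl,
      coeff_depthPart, if_pos rfl, Finset.mul_sum]
    refine Finset.sum_congr rfl fun k hk => ?_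
    rw [(mem_indexSet.1 hk).1, inv_pow]

theorem tendsto_allSeries {f : ℕ → ∀ r : ℕ, (Fin r → ℕ) → ℂ} {g : ∀ r : ℕ, (Fin r → ℕ) → ℂ}
    (h : ∀ (r : ℕ) (k : Fin r → ℕ), (∀ i, 1 ≤ k i) →
      Tendsto (fun n => f n r k) atTop (𝓝 (g r k))) :
    Tendsto (fun n => allSeries (f n)) atTop (𝓝 (allSeries g)) := by
  rw [MvPowerSeries.WithPiTopology.tendsto_iff_coeff_tendsto]
  intro e
  exact tendsto_finsetSum _ fun k hk => h _ k (mem_indexSet.1 hk).2.1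

theorem xi_depth_zero (k : Fin 0 → ℕ) : xi k = 1 :=
  tendsto_nhds_unique (tendsto_xi k fun i => i.elim0)
    (tendsto_const_nhds.congr fun n => (z_depth_zero n k _).symm)

theorem xiStar_depth_zero (k : Fin 0 → ℕ) : xiStar k = 1 :=
  tendsto_nhds_unique (tendsto_xiStar k fun i => i.elim0)
    (tendsto_const_nhds.congr fun n => (zStar_depth_zero n k _).symm)

theorem tendsto_zSeries :
    Tendsto (fun n => zSeries (-2 * Real.pi * Complex.I : ℂ)⁻¹ (rootE n) n) atTop
      (𝓝 (genSeries xi)) := by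
  rw [genSeries_eq_allSeries _ (xi_depth_zero _)]
  exact tendsto_allSeries fun r k hk => (tendsto_xi k hk).const_mul _

theorem tendsto_zStarSeries :
    Tendsto (fun n => zStarSeries (-2 * Real.pi * Complex.I : ℂ)⁻¹ (rootE n) n) atTop
      (𝓝 (genSeries xiStar)) := by
  rw [genSeries_eq_allSeries _ (xiStar_depth_zero _)]
  exact tendsto_allSeries fun r k hk => (tendsto_xiStar k hk).const_mul _

/-- The numerator of the generating function, up to the factor `e ^ ((x + y) / 2)`. -/
noncomputable def limNumerator (y z : Series) : Series :=
  vX * (sExp vX + sExp y - 2 * (sCoshSqrt ((1 / 4 : ℂ) • ((vX + y) ^ 2 - 4 * z)) *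
    sExp ((1 / 2 : ℂ) • (vX + y))))

/-- The denominator of the generating function, up to the factor `e ^ ((x + y) / 2)`. -/
noncomputable def limDenominator (y z : Series) : Series := (sExp vX - 1) * (z - vX * y)

theorem C_half_mul_two : (MvPowerSeries.C (1 / 2) : Series) * 2 = 1 := by
  rw [← map_ofNat (MvPowerSeries.C (σ := Fin 3) (R := ℂ)) 2, ← map_mul]
  simp

/-- This is the limit of `prod_letterSeries`, used with `ε = 1` for `ξ` and `ε = -1` for `ξ⋆`. Since
`n (1 - q) → -2πi = κ⁻¹`, the series `nX`, `nY`, `n²Z` tend to `x`, `εy`, `εz`. -/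
theorem exists_tendsto_num_den (ε : ℂ) : ∃ D N : ℕ → Series,
    Tendsto D atTop (𝓝 (limDenominator (MvPowerSeries.C ε * vY) (MvPowerSeries.C ε * vZ))) ∧
    Tendsto N atTop (𝓝 (limNumerator (MvPowerSeries.C ε * vY) (MvPowerSeries.C ε * vZ))) ∧
    ∀ᶠ n in atTop, (∏ m ∈ Finset.range n, (1 + MvPowerSeries.C ε * letterSeries (rootE n ^ m)
      ((-2 * Real.pi * Complex.I : ℂ)⁻¹ / qInt (rootE n) m))) * D n = N n := by
  set κ : ℂ := (-2 * Real.pi * Complex.I : ℂ)⁻¹ with hκ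
  have hκ0 : (-2 * Real.pi * Complex.I : ℂ) ≠ 0 := by
    simp
  let v : ℕ → Series := fun n => MvPowerSeries.C (κ * (1 - rootE n))
  let c : Series := MvPowerSeries.C ε
  let X : ℕ → Series := fun n => v n * vX
  let Y : ℕ → Series := fun n => c * v n * vY
  let Z : ℕ → Series := fun n => c * v n ^ 2 * vZ
  let σ : ℕ → Series := fun n => MvPowerSeries.C (1 / 2) * (X n + Y n + X n * Y n - Z n)
  let W : ℕ → Series := fun n => (1 + σ n) ^ 2 - (1 + Y n) * (1 + X n)
  have hC2 := C_half_mul_two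
  have hC4 : (MvPowerSeries.C (1 / 4) : Series) = MvPowerSeries.C (1 / 2) ^ 2 := by
    rw [← map_pow]
    norm_num
  have hcont := MvPowerSeries.WithPiTopology.continuous_C (σ := Fin 3) (R := ℂ)
  have hv : Tendsto v atTop (𝓝 0) := by
    have h := (((tendsto_const_nhds (x := (1 : ℂ))).sub tendsto_rootE).const_mul κ)
    rw [sub_self, mul_zero] at h
    have := (hcont.tendsto 0).comp h
    rwa [map_zero] at this
  have hu : Tendsto (fun n : ℕ => (n : Series) * v n) atTop (𝓝 1) := by
    have h := tendsto_nat_mul_one_sub_rootE.const_mul κ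
    rw [hκ, inv_mul_cancel₀ hκ0, ← hκ] at h
    have := (hcont.tendsto 1).comp h
    rw [map_one] at this
    refine this.congr fun n => ?_
    simp only [v, Function.comp_apply, ← C_natCast, ← map_mul]
    congr 1
    ring
  have hX0 : ∀ n, MvPowerSeries.constantCoeff (X n) = 0 := fun n => by simp [X, vX]
  have hY0 : ∀ n, MvPowerSeries.constantCoeff (Y n) = 0 := fun n => by simp [Y, vY]
  have hZ0 : ∀ n, MvPowerSeries.constantCoeff (Z n) = 0 := fun n => by simp [Z, vZ]
  have hσ0 : ∀ n, MvPowerSeries.constantCoeff (σ n) = 0 := fun n => by simp [σ, hX0, hY0, hZ0]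
  have hW0 : ∀ n, MvPowerSeries.constantCoeff (W n) = 0 := fun n => by
    simp [W, hσ0, hX0, hY0]
  have hX : Tendsto (fun n : ℕ => (n : Series) * X n) atTop (𝓝 vX) := by
    have := hu.mul_const vX
    rw [one_mul] at this
    exact this.congr fun n => by simp only [X]; ring
  have hY : Tendsto (fun n : ℕ => (n : Series) * Y n) atTop (𝓝 (c * vY)) := by
    have := hu.mul_const (c * vY)
    rw [one_mul] at this
    exact this.congr fun n => by simp only [Y]; ring
  have hZ : Tendsto (fun n : ℕ => (n : Series) ^ 2 * Z n) atTop (𝓝 (c * vZ)) := by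
    have := (hu.pow 2).mul_const (c * vZ)
    rw [one_pow, one_mul] at this
    exact this.congr fun n => by simp only [Z]; ring
  have hσ : Tendsto (fun n : ℕ => (n : Series) * σ n) atTop
      (𝓝 ((1 / 2 : ℂ) • (vX + c * vY))) := by
    have := ((hX.add hY).add ((hu.mul hv).mul_const (c * vX * vY - c * vZ))).const_mul
      (MvPowerSeries.C (1 / 2))
    rw [mul_zero, zero_mul, add_zero] at this
    rw [MvPowerSeries.smul_eq_C_mul]
    exact this.congr fun n => by simp only [σ, X, Y, Z]; ring
  have hW : Tendsto (fun n : ℕ => (n : Series) ^ 2 * W n) atTop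
      (𝓝 ((1 / 4 : ℂ) • ((vX + c * vY) ^ 2 - 4 * (c * vZ)))) := by
    have := (hσ.pow 2).sub hZ
    have e : ((1 / 2 : ℂ) • (vX + c * vY)) ^ 2 - c * vZ =
        (1 / 4 : ℂ) • ((vX + c * vY) ^ 2 - 4 * (c * vZ)) := by
      rw [MvPowerSeries.smul_eq_C_mul, MvPowerSeries.smul_eq_C_mul, hC4]
      linear_combination (2 * MvPowerSeries.C (1 / 2) + 1) * (c * vZ) * hC2
    rw [e] at this
    refine this.congr fun n => ?_
    simp only [W, σ]
    linear_combination (-(n : Series) ^ 2 * (X n + Y n + X n * Y n - Z n)) * hC2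
  -- The identity is multiplied by one more `n`, so that `X` and `Z - XY` appear with scalings that
  -- converge.
  refine ⟨fun n => ((1 + X n) ^ n - 1) * ((n : Series) ^ 2 * Z n - (n : Series) * X n * (n * Y n)),
    fun n => (n : Series) * X n * ((1 + X n) ^ n + (1 + Y n) ^ n - conjPowSum n (1 + σ n) (W n)),
    ?_, ?_, ?_⟩
  · exact ((tendsto_one_add_pow hX0 hX 0).sub tendsto_const_nhds).mul (hZ.sub (hX.mul hY))
  · exact hX.mul (((tendsto_one_add_pow hX0 hX 0).add (tendsto_one_add_pow hY0 hY 0)).sub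
      (tendsto_conjPowSum hσ0 hW0 hσ hW))
  · filter_upwards [eventually_gt_atTop 0] with n hn
    have h := prod_letterSeries hn (rootE_primitive hn.ne') ε κ (X := X n) (Y := Y n) (Z := Z n)
      (h := 1 + σ n) rfl (by simp [Y, v, c]) (by simp [Z, v, c])
      (by simp only [σ]; linear_combination (X n + Y n + X n * Y n - Z n) * hC2)
    simp only [W]
    linear_combination (n : Series) * h

theorem genSeries_xi_mul : genSeries xi * limDenominator vY vZ = limNumerator vY vZ := by
  obtain ⟨D, N, hD, hN, h⟩ := exists_tendsto_num_den 1
  simp only [map_one, one_mul] at hD hN h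
  refine tendsto_nhds_unique ((tendsto_zSeries.mul hD).congr' ?_) hN
  filter_upwards [h] with n hn
  rw [zSeries_eq_prod, hn]

theorem genSeries_xiStar_mul :
    genSeries xiStar * limNumerator (-vY) (-vZ) = limDenominator (-vY) (-vZ) := by
  obtain ⟨D, N, hD, hN, h⟩ := exists_tendsto_num_den (-1)
  simp only [map_neg, map_one, neg_one_mul, ← sub_eq_add_neg] at hD hN h
  refine tendsto_nhds_unique ((tendsto_zStarSeries.mul hN).congr' ?_) hD
  filter_upwards [h] with n hn
  rw [← hn, ← mul_assoc, zStarSeries_mul_prod, one_mul]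

/-! ### Rewriting the limit as `U` in the field of fractions. -/

theorem sExp_zero : sExp 0 = 1 := by
  refine tendsto_nhds_unique (tendsto_one_add_pow (σ := fun _ => 0) (fun _ => map_zero _)
    (by simp) 0) ?_
  simp

theorem sExp_mul_sExp_neg {a : Series} (ha : MvPowerSeries.constantCoeff a = 0) :
    sExp a * sExp (-a) = 1 := by
  rw [← sExp_add ha (by rw [map_neg, ha, neg_zero]), add_neg_cancel, sExp_zero]

theorem sExp_half_sq {a : Series} (ha : MvPowerSeries.constantCoeff a = 0) :
    sExp ((1 / 2 : ℂ) • a) ^ 2 = sExp a := by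
  have h : MvPowerSeries.constantCoeff ((1 / 2 : ℂ) • a) = 0 := by simp [ha]
  rw [sq, ← sExp_add h h, ← add_smul]
  norm_num

theorem constantCoeff_vX : MvPowerSeries.constantCoeff vX = 0 := by simp [vX]

theorem sExp_vX_sub_one_ne_zero : sExp vX - 1 ≠ 0 := by
  intro h
  have := congrArg (MvPowerSeries.coeff (Finsupp.single 0 1)) h
  rw [sExp, vX, map_sub, PowerSeries.coeff_subst_single, MvPowerSeries.coeff_one] at this
  simp [PowerSeries.coeff_exp] at this

theorem vZ_sub_ne_zero : vZ - vX * vY ≠ 0 := by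
  intro h
  have := congrArg (MvPowerSeries.coeff (Finsupp.single 2 1)) h
  rw [vX, vY, vZ, map_sub, MvPowerSeries.coeff_X, MvPowerSeries.X, MvPowerSeries.X,
    MvPowerSeries.monomial_mul_monomial, MvPowerSeries.coeff_monomial, if_pos rfl, if_neg] at this
  · simp at this
  · intro h2
    have := DFunLike.congr_fun h2 0
    simp at this

theorem limDenominator_ne_zero : limDenominator vY vZ ≠ 0 :=
  mul_ne_zero sExp_vX_sub_one_ne_zero vZ_sub_ne_zero

theorem limDenominator_neg_ne_zero : limDenominator (-vY) (-vZ) ≠ 0 := by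
  refine mul_ne_zero sExp_vX_sub_one_ne_zero ?_
  rw [mul_neg, ← neg_sub', neg_ne_zero]
  exact vZ_sub_ne_zero

/-- The factor `-2 e^(x/2)` is also split off from the numerator in `limNumerator_eq`, so it cancels
in the quotient. -/
theorem limDenominator_eq (y z : Series) :
    limDenominator y z = (-2 * sExp ((1 / 2 : ℂ) • vX)) *
      (sSinh ((1 / 2 : ℂ) • vX) * (vX * y - z)) := by
  have h1 := sExp_half_sq constantCoeff_vX
  have h2 := sExp_mul_sExp_neg (a := (1 / 2 : ℂ) • vX) (by simp [constantCoeff_vX])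
  rw [limDenominator, ← h1, sSinh, MvPowerSeries.smul_eq_C_mul (_ - _)]
  linear_combination (z - vX * y) * ((sExp ((1 / 2 : ℂ) • vX) * sExp (-((1 / 2 : ℂ) • vX)) -
    sExp ((1 / 2 : ℂ) • vX) ^ 2) * C_half_mul_two + h2)

theorem limNumerator_eq {y : Series} (hy : MvPowerSeries.constantCoeff y = 0) (z : Series) :
    limNumerator y z = (-2 * sExp ((1 / 2 : ℂ) • vX)) *
      (sExp ((1 / 2 : ℂ) • y) * vX *
        (sCoshSqrt ((1 / 4 : ℂ) • ((vX + y) ^ 2 - 4 * z)) - sCosh ((1 / 2 : ℂ) • (vX - y)))) := by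
  have hx' : MvPowerSeries.constantCoeff ((1 / 2 : ℂ) • vX) = 0 := by simp [constantCoeff_vX]
  have hy' : MvPowerSeries.constantCoeff ((1 / 2 : ℂ) • y) = 0 := by simp [hy]
  have h1 := sExp_half_sq constantCoeff_vX
  have h2 := sExp_half_sq hy
  have h3 := sExp_mul_sExp_neg hx'
  have h4 := sExp_mul_sExp_neg hy'
  have e1 : (1 / 2 : ℂ) • (vX - y) = (1 / 2 : ℂ) • vX + -((1 / 2 : ℂ) • y) := by
    rw [smul_sub, sub_eq_add_neg]
  have e2 : -((1 / 2 : ℂ) • vX + -((1 / 2 : ℂ) • y)) = -((1 / 2 : ℂ) • vX) + (1 / 2 : ℂ) • y := by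
    ring
  rw [limNumerator, ← h1, ← h2, sCosh, MvPowerSeries.smul_eq_C_mul (sExp _ + _), e1, e2,
    sExp_add hx' (by rw [map_neg, hy', neg_zero]), sExp_add (by rw [map_neg, hx', neg_zero]) hy',
    smul_add (1 / 2 : ℂ) vX y, sExp_add hx' hy']
  generalize sExp ((1 / 2 : ℂ) • vX) = a at *
  generalize sExp ((1 / 2 : ℂ) • y) = b at *
  generalize sExp (-((1 / 2 : ℂ) • vX)) = a' at *
  generalize sExp (-((1 / 2 : ℂ) • y)) = b' at *
  linear_combination (-vX * a * b * (a * b' + a' * b)) * C_half_mul_two - vX * b ^ 2 * h3 -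
    vX * a ^ 2 * h4

theorem U_eq_div {y : Series} (hy : MvPowerSeries.constantCoeff y = 0) (z : Series) :
    U vX y z = algebraMap Series SeriesField (limNumerator y z) /
      algebraMap Series SeriesField (limDenominator y z) := by
  have hk : algebraMap Series SeriesField (-2 * sExp ((1 / 2 : ℂ) • vX)) ≠ 0 := by
    rw [Ne, IsFractionRing.to_map_eq_zero_iff]
    intro h
    have h1 := sExp_half_sq constantCoeff_vX
    have h2 := sExp_mul_sExp_neg (a := (1 / 2 : ℂ) • vX) (by simp [constantCoeff_vX])
    have : (1 : Series) = 0 := by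
      linear_combination (-MvPowerSeries.C (1 / 2) * sExp (-((1 / 2 : ℂ) • vX))) * h -
        (sExp ((1 / 2 : ℂ) • vX) * sExp (-((1 / 2 : ℂ) • vX))) * C_half_mul_two - h2
    exact one_ne_zero this
  rw [limNumerator_eq hy, limDenominator_eq, map_mul _ (-2 * _), map_mul _ (-2 * _),
    mul_div_mul_left _ _ hk, U]
  simp only [map_mul]
  rw [mul_assoc, div_mul_div_comm, ← mul_div_assoc, mul_assoc]

theorem genSeries_xi_eq :
    algebraMap Series SeriesField (genSeries xi) = U vX vY vZ := by
  rw [U_eq_div (by simp [vY]), ← genSeries_xi_mul, map_mul, mul_div_cancel_right₀]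
  rw [Ne, IsFractionRing.to_map_eq_zero_iff]
  exact limDenominator_ne_zero

theorem limNumerator_neg_ne_zero : limNumerator (-vY) (-vZ) ≠ 0 := by
  intro h
  apply limDenominator_neg_ne_zero
  rw [← genSeries_xiStar_mul, h, mul_zero]

theorem genSeries_xiStar_eq :
    algebraMap Series SeriesField (genSeries xiStar) = (U vX (-vY) (-vZ))⁻¹ := by
  rw [U_eq_div (by simp [vY]), inv_div, ← genSeries_xiStar_mul, map_mul, mul_div_cancel_right₀]
  rw [Ne, IsFractionRing.to_map_eq_zero_iff]
  exact limNumerator_neg_ne_zero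

/-! ### Rationality of the coefficients. -/

/-- The power series with rational coefficients. -/
noncomputable def ratSeries : Subring Series := (MvPowerSeries.map (algebraMap ℚ ℂ)).range

theorem mem_ratSeries_iff {f : Series} :
    f ∈ ratSeries ↔ ∀ e, MvPowerSeries.coeff e f ∈ (algebraMap ℚ ℂ).range := by
  constructor
  · rintro ⟨g, rfl⟩ e
    exact ⟨_, (MvPowerSeries.coeff_map _ _ _).symm⟩
  · intro h
    choose g hg using h
    let G : MvPowerSeries (Fin 3) ℚ := g
    refine ⟨G, ?_⟩
    ext e
    rw [MvPowerSeries.coeff_map, ← hg e]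
    rfl

theorem smul_mem_ratSeries (c : ℚ) {f : Series} (hf : f ∈ ratSeries) : (c : ℂ) • f ∈ ratSeries := by
  rw [mem_ratSeries_iff] at hf ⊢
  intro e
  rw [MvPowerSeries.coeff_smul]
  exact mul_mem ⟨c, rfl⟩ (hf e)

theorem subst_mem_ratSeries {τ : Series} (h0 : MvPowerSeries.constantCoeff τ = 0)
    (hτ : τ ∈ ratSeries) {f : PowerSeries ℂ}
    (hf : ∀ i, PowerSeries.coeff i f ∈ (algebraMap ℚ ℂ).range) : f.subst τ ∈ ratSeries := by
  rw [mem_ratSeries_iff]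
  intro e
  rw [coeff_subst_eq_sum h0]
  exact sum_mem fun i _ => mul_mem (hf i) (mem_ratSeries_iff.1 (pow_mem hτ i) e)

theorem sExp_mem_ratSeries {τ : Series} (h0 : MvPowerSeries.constantCoeff τ = 0)
    (hτ : τ ∈ ratSeries) : sExp τ ∈ ratSeries :=
  subst_mem_ratSeries h0 hτ fun i => ⟨1 / (i.factorial : ℚ), by simp [PowerSeries.coeff_exp]⟩

theorem sCoshSqrt_mem_ratSeries {τ : Series} (h0 : MvPowerSeries.constantCoeff τ = 0)
    (hτ : τ ∈ ratSeries) : sCoshSqrt τ ∈ ratSeries :=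
  subst_mem_ratSeries h0 hτ fun i => ⟨1 / ((2 * i).factorial : ℚ), by simp⟩

theorem X_mem_ratSeries (i : Fin 3) : (MvPowerSeries.X i : Series) ∈ ratSeries :=
  ⟨MvPowerSeries.X i, MvPowerSeries.map_X _ _⟩

theorem limDenominator_mem_ratSeries {y z : Series} (hy : y ∈ ratSeries) (hz : z ∈ ratSeries) :
    limDenominator y z ∈ ratSeries :=
  have hx : vX ∈ ratSeries := X_mem_ratSeries 0
  mul_mem (sub_mem (sExp_mem_ratSeries constantCoeff_vX hx) (one_mem _)) (sub_mem hz (mul_mem hx hy))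

theorem limNumerator_mem_ratSeries {y z : Series} (hy : y ∈ ratSeries) (hz : z ∈ ratSeries)
    (hy0 : MvPowerSeries.constantCoeff y = 0) (hz0 : MvPowerSeries.constantCoeff z = 0) :
    limNumerator y z ∈ ratSeries := by
  have hx : vX ∈ ratSeries := X_mem_ratSeries 0
  have h2 := smul_mem_ratSeries (1 / 2) (add_mem hx hy)
  have h4 := smul_mem_ratSeries (1 / 4)
    (sub_mem (pow_mem (add_mem hx hy) 2) (mul_mem (ofNat_mem ratSeries 4) hz))
  push_cast at h2 h4
  refine mul_mem hx (sub_mem (add_mem (sExp_mem_ratSeries constantCoeff_vX hx)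
    (sExp_mem_ratSeries hy0 hy)) (mul_mem (ofNat_mem ratSeries 2) (mul_mem
      (sCoshSqrt_mem_ratSeries ?_ h4) (sExp_mem_ratSeries ?_ h2))))
  · simp [constantCoeff_vX, hy0, hz0]
  · simp [constantCoeff_vX, hy0]

/-- A quotient of power series with rational coefficients has rational coefficients. -/
theorem mem_ratSeries_of_mul_mem {g d : Series} (hd : d ∈ ratSeries) (hd0 : d ≠ 0)
    (h : g * d ∈ ratSeries) : g ∈ ratSeries := by
  -- The series `d` need not be invertible. A `ℚ`-linear retraction `π` of `ℂ` onto `ℚ`, applied to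
  -- the coefficients of `g`, does not change the product with `d`, because `d` and `g * d` are
  -- rational; cancelling `d` shows that `g` is fixed.
  obtain ⟨π, hπ⟩ := (Algebra.linearMap ℚ ℂ).exists_leftInverse_of_injective
    (LinearMap.ker_eq_bot.2 (algebraMap ℚ ℂ).injective)
  have hπ' : ∀ c : ℚ, π (algebraMap ℚ ℂ c) = c := fun c => LinearMap.congr_fun hπ c
  let g' : Series := fun e => algebraMap ℚ ℂ (π (MvPowerSeries.coeff e g))
  have hg' : ∀ e, MvPowerSeries.coeff e g' = algebraMap ℚ ℂ (π (MvPowerSeries.coeff e g)) :=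
    fun _ => rfl
  have key : g' * d = g * d := by
    ext e
    obtain ⟨c, hc⟩ := mem_ratSeries_iff.1 h e
    rw [← hc, ← hπ' c, hc, MvPowerSeries.coeff_mul, MvPowerSeries.coeff_mul, map_sum, map_sum]
    refine Finset.sum_congr rfl fun p _ => ?_
    obtain ⟨b, hb⟩ := mem_ratSeries_iff.1 hd p.2
    have e1 : MvPowerSeries.coeff p.1 g * algebraMap ℚ ℂ b = b • MvPowerSeries.coeff p.1 g := by
      rw [mul_comm, ← Algebra.smul_def]
    rw [hg', ← hb, e1, map_smul, smul_eq_mul, map_mul, mul_comm]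
  rw [← mul_right_cancel₀ hd0 key, mem_ratSeries_iff]
  exact fun e => ⟨_, (hg' e).symm⟩

theorem genSeries_xi_mem_ratSeries : genSeries xi ∈ ratSeries := by
  have hy : vY ∈ ratSeries := X_mem_ratSeries 1
  have hz : vZ ∈ ratSeries := X_mem_ratSeries 2
  refine mem_ratSeries_of_mul_mem (limDenominator_mem_ratSeries hy hz) limDenominator_ne_zero ?_
  rw [genSeries_xi_mul]
  exact limNumerator_mem_ratSeries hy hz (by simp [vY]) (by simp [vZ])

theorem genSeries_xiStar_mem_ratSeries : genSeries xiStar ∈ ratSeries := by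
  have hy : -vY ∈ ratSeries := neg_mem (X_mem_ratSeries 1)
  have hz : -vZ ∈ ratSeries := neg_mem (X_mem_ratSeries 2)
  refine mem_ratSeries_of_mul_mem
    (limNumerator_mem_ratSeries hy hz (by simp [vY]) (by simp [vZ])) limNumerator_neg_ne_zero ?_
  rw [genSeries_xiStar_mul]
  exact limDenominator_mem_ratSeries hy hz

theorem exists_rat_sum_eq {f : ∀ {r : ℕ}, (Fin r → ℕ) → ℂ} (h0 : f (default : Fin 0 → ℕ) = 1)
    (hf : genSeries f ∈ ratSeries) (w r s : ℕ) :
    ∃ c : ℚ, ∑ k ∈ indexSet w r s, f k = (-2 * Real.pi * Complex.I : ℂ) ^ w * (c : ℂ) := by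
  -- If an index exists, its exponent `expo k₀` locates the sum as a coefficient, without the
  -- subtractions `w - r - s` and `r - s`.
  rcases (indexSet w r s).eq_empty_or_nonempty with h | ⟨k₀, hk₀⟩
  · exact ⟨0, by simp [h]⟩
  · obtain ⟨h1, h2, h3⟩ := mem_indexSet.1 hk₀
    obtain ⟨c, hc⟩ := mem_ratSeries_iff.1 hf (expo k₀)
    refine ⟨c, ?_⟩
    have hne : (-2 * Real.pi * Complex.I : ℂ) ≠ 0 := by simp
    rw [genSeries_eq_allSeries _ h0, coeff_allSeries _ _ (expo_one_add_expo_two k₀), coeff_depthPart,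
      if_pos (expo_one_add_expo_two k₀), ← weight_eq_expo k₀ h2, ← height_eq_expo_two k₀ h2, h1,
      h3] at hc
    change _ = _ * algebraMap ℚ ℂ c
    rw [hc, Finset.mul_sum]
    refine Finset.sum_congr rfl fun k hk => ?_
    rw [(mem_indexSet.1 hk).1, inv_pow, mul_inv_cancel_left₀ (pow_ne_zero _ hne)]

end MultHarmonic

theorem mainTheorem4 :
    -- the limits defining `ξ(𝐤)` and `ξ⋆(𝐤)` exist
    (∀ (r : ℕ) (k : Fin r → ℕ), 1 ≤ r → (∀ a, 1 ≤ k a) →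
      Filter.Tendsto (fun n : ℕ => MultHarmonic.z n k (MultHarmonic.rootE n)) Filter.atTop
        (nhds (MultHarmonic.xi k)) ∧
      Filter.Tendsto (fun n : ℕ => MultHarmonic.zStar n k (MultHarmonic.rootE n)) Filter.atTop
        (nhds (MultHarmonic.xiStar k))) ∧
    -- the sums of fixed weight, depth and height lie in `(-2πi)^k ℚ`
    (∀ k r s : ℕ, 1 ≤ r →
      (∃ c : ℚ, ∑ i ∈ MultHarmonic.indexSet k r s, MultHarmonic.xi i =
        (-2 * Real.pi * Complex.I) ^ k * (c : ℂ)) ∧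
      (∃ c : ℚ, ∑ i ∈ MultHarmonic.indexSet k r s, MultHarmonic.xiStar i =
        (-2 * Real.pi * Complex.I) ^ k * (c : ℂ))) ∧
    -- the generating functions
    algebraMap MultHarmonic.Series MultHarmonic.SeriesField
        (MultHarmonic.genSeries MultHarmonic.xi) =
      MultHarmonic.U MultHarmonic.vX MultHarmonic.vY MultHarmonic.vZ ∧
    algebraMap MultHarmonic.Series MultHarmonic.SeriesField
        (MultHarmonic.genSeries MultHarmonic.xiStar) =
      (MultHarmonic.U MultHarmonic.vX (-MultHarmonic.vY) (-MultHarmonic.vZ))⁻¹ := by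
  refine ⟨fun r k _ hk => ⟨MultHarmonic.tendsto_xi k hk, MultHarmonic.tendsto_xiStar k hk⟩,
    fun k r s _ => ⟨?_, ?_⟩, MultHarmonic.genSeries_xi_eq, MultHarmonic.genSeries_xiStar_eq⟩
  · exact MultHarmonic.exists_rat_sum_eq (MultHarmonic.xi_depth_zero _)
      MultHarmonic.genSeries_xi_mem_ratSeries k r s
  · exact MultHarmonic.exists_rat_sum_eq (MultHarmonic.xiStar_depth_zero _)
      MultHarmonic.genSeries_xiStar_mem_ratSeries k r s
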